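/- Let $s>5/2$ be real and $S^1=\mathbb R/\mathbb Z$. Let $H^s_0(S^1)$ be the space of real functions $u\in H^s(S^1)$ with $u(0)=0$, let $\mathrm{Diff}^s_0(S^1)$ be the set of orientation-preserving diffeomorphisms $\varphi$ of $S^1$ of Sobolev class $H^s$ with $\varphi(0)=0$ (an open subset of $\mathrm{id}+H^s_0(S^1)$), and let $H^{s-1}(S^1)/\mathbb R$ be $H^{s-1}(S^1)$ modulo constant functions. Let $$K^s=\mathrm{Diff}^s_0(S^1)\times\bigl(H^{s-1}(S^1)/\mathbb R\bigr),\qquad T_{(\varphi,[\alpha])}K^s\simeq H^s_0(S^1)\times\bigl(H^{s-1}(S^1)/\mathbb R\bigr).$$ For $U=(U_1,[U_2])$ and $V=(V_1,[V_2])$ in $T_{(\varphi,[\alpha])}K^s$ put $\pi(U_2)=U_2-\int_{S^1}U_2\varphi_x\,dx$ and $$\langle U,V\rangle_{(\varphi,[\alpha])}=\frac14\int_{S^1}\Bigl(\frac{U_{1x}V_{1x}}{\varphi_x}-\pi(U_2)\pi(V_2)\varphi_x\Bigr)dx,\qquad \omega(U,V)=\frac14\int_{S^1}(U_{2x}V_1-V_{2x}U_1)\,dx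 .$$ Let $A=-\partial_x^2$, with inverse $A^{-1}$ taking functions of zero mean to functions vanishing at $0$. Let $\nabla$ be the connection $\nabla_XY=DY\cdot X-\Gamma(Y,X)$ on $K^s$, where $$\Gamma_{(\mathrm{id},[0])}(u,v)=-\frac12\Bigl(A^{-1}\partial_x\bigl(u_{1x}v_{1x}-\pi(u_2)\pi(v_2)\bigr),\ \bigl[u_{1x}\pi(v_2)+v_{1x}\pi(u_2)\bigr]\Bigr),$$ $$\Gamma_{(\varphi,[\alpha])}(u\circ\varphi,v\circ\varphi)=\Gamma_{(\mathrm{id},[0])}(u,v)\circ\varphi ,$$ and let $R(X,Y)Z=\nabla_X\nabla_YZ-\nabla_Y\nabla_XZ-\nabla_{[X,Y]}Z$ be its curvature. Theorem. For smooth vector fields $X,Y,Z$ on $K^s$, the value of $R(X,Y)Z$ at $(\mathrm{id},[0])$ depends only on the values of $X,Y,Z$ at that point. The resulting curvature tensor satisfies $$\langle R(u,v)v,u\rangle=\langle u,u\rangle\langle v,v\rangle-\langle u,v\rangle^2-3\,\omega(u,v)^2\qquad\text{for all }u,v\in T_{(\mathrm{id},[0])}K^s .$$ In particular, the sectional curvature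 $$\sec(u,v)=\frac{\langle R(u,v)v,u\rangle}{\langle u,u\rangle\langle v,v\rangle-\langle u,v\rangle^2},$$ for $u,v\in T_{(\mathrm{id},[0])}K^s$ with nonzero denominator, takes on arbitrarily large positive as well as arbitrarily large negative values: for every $C\in\mathbb R$ there are such $u,v$ with $\sec(u,v)>C$ and such $u,v$ with $\sec(u,v)<C$. -/

import Mathlib

open scoped ContDiff

noncomputable section

/-- The Fourier coefficients of a continuous real function on `S¹ = ℝ/ℤ`, multiplied by the Sobolev
weights `(1 + k²)^(s/2)`. -/
def weightedFourier (s : ℝ) (f : C(UnitAddCircle, ℝ)) (k : ℤ) : ℂ :=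
  (((1 + (k : ℝ) ^ 2) ^ (s / 2) : ℝ) : ℂ) * fourierCoeff (fun x => (f x : ℂ)) k

theorem weightedFourier_add (s : ℝ) (f g : C(UnitAddCircle, ℝ)) :
    weightedFourier s (f + g) = weightedFourier s f + weightedFourier s g := by
  funext k
  have hi : ∀ h : C(UnitAddCircle, ℝ),
      MeasureTheory.Integrable (fun x => (h x : ℂ)) (AddCircle.haarAddCircle (T := 1)) := fun h =>
    (Complex.continuous_ofReal.comp h.continuous).integrable_of_hasCompactSupport
      (HasCompactSupport.of_compactSpace _)
  have h := congrFun (fourierCoeff.add (hi f) (hi g)) k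
  have e : (fun x => ((f + g) x : ℂ)) = (fun x => (f x : ℂ)) + fun x => (g x : ℂ) := by
    funext x; simp
  simp only [weightedFourier, Pi.add_apply, e, h, mul_add]

theorem weightedFourier_smul (s c : ℝ) (f : C(UnitAddCircle, ℝ)) :
    weightedFourier s (c • f) = c • weightedFourier s f := by
  funext k
  have h := fourierCoeff.const_mul (fun x : UnitAddCircle => (f x : ℂ)) (c : ℂ) k
  have e : (fun x => ((c • f) x : ℂ)) = fun x => (c : ℂ) * (f x : ℂ) := by
    funext x; simp
  simp only [weightedFourier, Pi.smul_apply, e, h, Complex.real_smul]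
  ring

theorem weightedFourier_injective (s : ℝ) : Function.Injective (weightedFourier s) := by
  have key : ∀ f : C(UnitAddCircle, ℝ), weightedFourier s f = 0 → f = 0 := by
    intro f hf
    let F : C(UnitAddCircle, ℂ) := ⟨fun x => (f x : ℂ), Complex.continuous_ofReal.comp f.continuous⟩
    have h0 : ∀ k, fourierCoeff F k = 0 := by
      intro k
      have h := congrFun hf k
      simp only [weightedFourier, Pi.zero_apply, mul_eq_zero] at h
      rcases h with h | h
      · exfalso
        have : (0 : ℝ) < (1 + (k : ℝ) ^ 2) ^ (s / 2) := by positivity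
        exact this.ne' (by exact_mod_cast h)
      · exact h
    have hs : Summable (fourierCoeff F) := by
      have : fourierCoeff F = 0 := funext h0
      rw [this]; exact summable_zero
    ext x
    have h := has_pointwise_sum_fourier_series_of_summable hs x
    simp only [h0, zero_smul] at h
    have h' : F x = 0 := h.unique hasSum_zero
    simpa [F] using h'
  intro f g h
  have h2 : weightedFourier s (f - g) = 0 := by
    have := weightedFourier_add s (f - g) g
    rw [sub_add_cancel, h] at this
    simpa using this
  exact sub_eq_zero.mp (key _ h2)

/-- The functions of Sobolev class `H^s` on `S¹`, for `s > 1/2`: each `L²` class with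
`∑ (1 + k²)^s |f̂(k)|² < ∞` then has exactly one continuous representative, and `H^s(S¹)` is
identified with the space of these representatives. -/
def sobolevSubmodule (s : ℝ) : Submodule ℝ C(UnitAddCircle, ℝ) where
  carrier := {f | Memℓp (weightedFourier s f) 2}
  add_mem' {f g} hf hg := by
    simp only [Set.mem_ofPred_eq, weightedFourier_add] at *
    exact hf.add hg
  zero_mem' := by
    have h : weightedFourier s 0 = 0 := by simpa using weightedFourier_smul s 0 0
    simp only [Set.mem_ofPred_eq, h]
    exact zero_memℓp
  smul_mem' c f hf := by
    simp only [Set.mem_ofPred_eq, weightedFourier_smul] at *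
    exact hf.const_smul c

/-- The Sobolev space `H^s(S¹)`, `s > 1/2`, with the norm
`‖f‖ = (∑ (1 + k²)^s |f̂(k)|²)^(1/2)` (see `sobolevToLp`). -/
def Sobolev (s : ℝ) : Type := sobolevSubmodule s

namespace Sobolev

variable {s : ℝ}

instance : AddCommGroup (Sobolev s) := inferInstanceAs (AddCommGroup (sobolevSubmodule s))

instance : Module ℝ (Sobolev s) := inferInstanceAs (Module ℝ (sobolevSubmodule s))

/-- The inclusion `H^s(S¹) → C(S¹)`. -/
def toCont : Sobolev s →ₗ[ℝ] C(UnitAddCircle, ℝ) := (sobolevSubmodule s).subtype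

/-- An element of `H^s(S¹)` as a 1-periodic function on `ℝ`. -/
def per (f : Sobolev s) (x : ℝ) : ℝ := toCont f (x : UnitAddCircle)

end Sobolev

/-- The injective linear map `H^s(S¹) → ℓ²(ℤ)` that defines the norm. -/
def sobolevToLp (s : ℝ) : Sobolev s →ₗ[ℝ] lp (fun _ : ℤ => ℂ) 2 where
  toFun f := ⟨weightedFourier s (Sobolev.toCont f), f.2⟩
  map_add' _ _ := Subtype.ext (weightedFourier_add s _ _)
  map_smul' c _ := Subtype.ext (weightedFourier_smul s c _)

theorem sobolevToLp_injective (s : ℝ) : Function.Injective (sobolevToLp s) := by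
  intro f g h
  exact Subtype.ext (weightedFourier_injective s (congrArg Subtype.val h))

instance (s : ℝ) : NormedAddCommGroup (Sobolev s) :=
  NormedAddCommGroup.induced _ _ (sobolevToLp s) (sobolevToLp_injective s)

instance (s : ℝ) : NormedSpace ℝ (Sobolev s) :=
  NormedSpace.induced ℝ _ _ (sobolevToLp s)

theorem memℓp_weightedFourier_one (s : ℝ) :
    Memℓp (weightedFourier s (1 : C(UnitAddCircle, ℝ))) 2 := by
  refine memℓp_gen (summable_of_ne_finset_zero (s := {0}) fun k hk => ?_)
  have e : (fun x => (((1 : C(UnitAddCircle, ℝ)) x : ℝ) : ℂ)) =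
      (fourier 0 : C(UnitAddCircle, ℂ)) := by
    funext x; simp
  have hk' : k ≠ 0 := by simpa using hk
  rw [weightedFourier, e, fourierCoeff_fourier]
  simp [hk']

namespace Sobolev

/-- The constant function `1`. -/
def one (s : ℝ) : Sobolev s := ⟨1, memℓp_weightedFourier_one s⟩

/-- The constant functions, a closed line in `H^s(S¹)`. -/
def constants (s : ℝ) : Submodule ℝ (Sobolev s) := Submodule.span ℝ {one s}

instance (s : ℝ) : IsClosed (constants s : Set (Sobolev s)) := by
  unfold constants
  exact Submodule.closed_of_finiteDimensional _

/-- `H₀^s(S¹)`: the functions in `H^s(S¹)` that vanish at `0`. -/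
def vanishing (s : ℝ) : Submodule ℝ (Sobolev s) where
  carrier := {f | per f 0 = 0}
  add_mem' {f g} hf hg := by
    simp only [Set.mem_ofPred_eq, per, map_add, ContinuousMap.add_apply] at *
    rw [hf, hg, add_zero]
  zero_mem' := by simp [per]
  smul_mem' c f hf := by
    simp only [Set.mem_ofPred_eq, per, map_smul, ContinuousMap.smul_apply] at *
    rw [hf, smul_zero]

/-- The mean value `∫_{S¹} f dx`. -/
def mean {s : ℝ} (f : Sobolev s) : ℝ := ∫ x in (0 : ℝ)..1, per f x

theorem intervalIntegrable_per {s : ℝ} (f : Sobolev s) :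
    IntervalIntegrable (per f) MeasureTheory.volume 0 1 :=
  ((toCont f).continuous.comp (AddCircle.continuous_mk' 1)).intervalIntegrable 0 1

/-- The map `f ↦ f - ∫ f dx`. -/
def subMean (s : ℝ) : Sobolev s →ₗ[ℝ] Sobolev s where
  toFun f := f - mean f • one s
  map_add' f g := by
    have h : mean (f + g) = mean f + mean g := by
      unfold mean
      rw [← intervalIntegral.integral_add (intervalIntegrable_per f) (intervalIntegrable_per g)]
      simp [per]
    rw [h, add_smul]; abel
  map_smul' c f := by
    have h : mean (c • f) = c * mean f := by
      unfold mean
      rw [← intervalIntegral.integral_const_mul]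
      simp [per]
    rw [h, RingHom.id_apply, smul_sub, mul_smul]

/-- The representative of zero mean of a class in `H^s(S¹)/ℝ`. -/
def repr (s : ℝ) : (Sobolev s ⧸ constants s) →ₗ[ℝ] Sobolev s :=
  (constants s).liftQ (subMean s) <| by
    rw [constants, Submodule.span_singleton_le_iff_mem, LinearMap.mem_ker]
    have h1 : ∀ x : ℝ, per (one s) x = 1 := fun _ => rfl
    have h : mean (one s) = 1 := by simp [mean, h1]
    simp [subMean, h]

open Classical in
/-- The element of `H^s(S¹)` given by a 1-periodic function on `ℝ` of class `H^s` (and `0` for any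
other function). -/
def ofFun (s : ℝ) (f : ℝ → ℝ) : Sobolev s :=
  if h : ∃ g : Sobolev s, per g = f then h.choose else 0

open Classical in
/-- The element of `H₀^s(S¹)` given by a 1-periodic function on `ℝ` of class `H^s` that vanishes at
`0` (and `0` for any other function). -/
def ofFunVanishing (s : ℝ) (f : ℝ → ℝ) : vanishing s :=
  if h : ∃ g : vanishing s, per g.1 = f then h.choose else 0

end Sobolev

/-! ### The space `K^s = Diff₀^s(S¹) ⋉ (H^(s-1)(S¹)/ℝ)`, for `s > 5/2` -/

namespace HunterSaxton

open Sobolev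

/-- The Banach space `H₀^s(S¹) × H^(s-1)(S¹)/ℝ`: the model space and every tangent space of
`K^s`. -/
abbrev TangentK (s : ℝ) : Type :=
  vanishing s × (Sobolev (s - 1) ⧸ constants (s - 1))

variable {s : ℝ}

/-- The lift `φ = id + w : ℝ → ℝ` of the circle map with displacement `w`, for `p = (w, [α])`. -/
def flow (p : TangentK s) (x : ℝ) : ℝ := x + per p.1.1 x

/-- `K^s` in its global chart. An orientation-preserving `H^s` diffeomorphism `φ` of `S¹` with
`φ(0) = 0` has exactly one lift `id + w` with `w ∈ H₀^s(S¹)`, and `w ∈ H₀^s(S¹)` arises in this way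
iff `id + w` has positive derivative. The point `(φ, [α])` is represented by `(w, [α])`. -/
def K (s : ℝ) : Set (TangentK s) := {p | ∀ x, 0 < deriv (flow p) x}

/-- The first component of a tangent vector, as a 1-periodic function on `ℝ`. -/
def fst (U : TangentK s) : ℝ → ℝ := per U.1.1

/-- A representative of the second component of a tangent vector, as a 1-periodic function on `ℝ`.
None of the expressions below depends on the choice of the representative. -/
def snd (U : TangentK s) : ℝ → ℝ := per (repr (s - 1) U.2)

/-- `π(U₂) = U₂ - ∫_{S¹} U₂ φ_x dx` at the point `p = (φ, [α])`. -/
def proj (p U : TangentK s) (x : ℝ) : ℝ :=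
  snd U x - ∫ y in (0 : ℝ)..1, snd U y * deriv (flow p) y

/-- The metric `⟨U, V⟩ = ¼ ∫_{S¹} (U₁ₓ V₁ₓ / φₓ - π(U₂) π(V₂) φₓ) dx` at `p = (φ, [α])`. -/
def metric (p U V : TangentK s) : ℝ :=
  (1 / 4) * ∫ x in (0 : ℝ)..1,
    (deriv (fst U) x * deriv (fst V) x / deriv (flow p) x
      - proj p U x * proj p V x * deriv (flow p) x)

/-- The two-form `ω(U, V) = ¼ ∫_{S¹} (U₂ₓ V₁ - V₂ₓ U₁) dx`; the formula is the same at all points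
of `K^s`. -/
def symplectic (U V : TangentK s) : ℝ :=
  (1 / 4) * ∫ x in (0 : ℝ)..1, (deriv (snd U) x * fst V x - deriv (snd V) x * fst U x)

/-- The inverse of `A = -∂ₓ²` on functions of zero mean, with values in the functions that vanish
at `0`: `(A⁻¹f)(x) = -∫₀ˣ∫₀ʸ f(z) dz dy + x ∫_{S¹}∫₀ʸ f(z) dz dy`. -/
def invA (f : ℝ → ℝ) (x : ℝ) : ℝ :=
  -(∫ y in (0 : ℝ)..x, ∫ z in (0 : ℝ)..y, f z)
    + x * ∫ y in (0 : ℝ)..1, ∫ z in (0 : ℝ)..y, f z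

/-- `π(f) = f - ∫_{S¹} f dx`, the projection `proj` at the identity. -/
def projId (f : ℝ → ℝ) (x : ℝ) : ℝ := f x - ∫ y in (0 : ℝ)..1, f y

/-- The first component `-½ A⁻¹∂ₓ(u₁ₓ v₁ₓ - π(u₂) π(v₂))` of the Christoffel map at the identity. -/
def christoffelId₁ (u₁ u₂ v₁ v₂ : ℝ → ℝ) (x : ℝ) : ℝ :=
  -(1 / 2) * invA (deriv fun y => deriv u₁ y * deriv v₁ y - projId u₂ y * projId v₂ y) x

/-- A representative `-½ (u₁ₓ π(v₂) + v₁ₓ π(u₂))` of the second component of the Christoffel map at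
the identity. -/
def christoffelId₂ (u₁ u₂ v₁ v₂ : ℝ → ℝ) (x : ℝ) : ℝ :=
  -(1 / 2) * (deriv u₁ x * projId v₂ x + deriv v₁ x * projId u₂ x)

/-- The Christoffel map `Γ` at `p = (φ, [α])`, by right invariance:
`Γ_p(U, V) = Γ_(id,[0])(U ∘ φ⁻¹, V ∘ φ⁻¹) ∘ φ`. -/
def christoffel (p U V : TangentK s) : TangentK s :=
  let ψ : ℝ → ℝ := Function.invFun (flow p)
  (ofFunVanishing s
      (christoffelId₁ (fst U ∘ ψ) (snd U ∘ ψ) (fst V ∘ ψ) (snd V ∘ ψ) ∘ flow p),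
    (constants (s - 1)).mkQ (ofFun (s - 1)
      (christoffelId₂ (fst U ∘ ψ) (snd U ∘ ψ) (fst V ∘ ψ) (snd V ∘ ψ) ∘ flow p)))

/-- The connection `∇_X Y = DY · X - Γ(Y, X)`, on vector fields written in the chart. -/
def covDeriv (X Y : TangentK s → TangentK s) (p : TangentK s) : TangentK s :=
  fderiv ℝ Y p (X p) - christoffel p (Y p) (X p)

/-- The curvature `R(X, Y)Z = ∇_X ∇_Y Z - ∇_Y ∇_X Z - ∇_[X,Y] Z` of `∇`, on vector fields. -/
def curvature (X Y Z : TangentK s → TangentK s) (p : TangentK s) : TangentK s :=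
  covDeriv X (covDeriv Y Z) p - covDeriv Y (covDeriv X Z) p
    - covDeriv (VectorField.lieBracket ℝ X Y) Z p

/-- The curvature tensor `R(u, v)w` at `p` on tangent vectors, computed with the vector fields that
extend `u, v, w` and are constant in the chart. -/
def curvatureTensor (p u v w : TangentK s) : TangentK s :=
  curvature (fun _ => u) (fun _ => v) (fun _ => w) p

/-- The denominator `⟨u, u⟩⟨v, v⟩ - ⟨u, v⟩²` of the sectional curvature. -/
def areaForm (p u v : TangentK s) : ℝ :=
  metric p u u * metric p v v - metric p u v ^ 2

/-- The sectional curvature `⟨R(u, v)v, u⟩ / (⟨u, u⟩⟨v, v⟩ - ⟨u, v⟩²)`, meaningful where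
`areaForm p u v ≠ 0`. -/
def sec (p u v : TangentK s) : ℝ :=
  metric p (curvatureTensor p u v v) u / areaForm p u v

/-- The identity `(id, [0])` of `K^s`. -/
def idK (s : ℝ) : TangentK s := 0

end HunterSaxton

end

/-! In the chart the conjugation by φ in Γ disappears. Since A⁻¹∂ₓf(x) = -∫₀ˣ f + x∫f, the
substitution y = φ(z) turns the first component of Γ into ½(∫₀ˣ F - φ(x)∫F), where F = U₁ₓV₁ₓ/φₓ -
π(U₂)π(V₂)φₓ is four times the density of the metric, and the second into -½(U₁ₓπ(V₂) + V₁ₓπ(U₂))/φₓ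
(`christoffel_eq_chartChristoffel`). What remains is built from continuous linear and bilinear maps
and the reciprocal of φₓ, so Γ is differentiable at the identity by the product rule
(`hasDerivAt_chartChristoffel`, `differentiableAt_chartChristoffel`).

The curvature of such a connection is D_YΓ(Z,X) - D_XΓ(Z,Y) + Γ(Γ(Z,Y),X) - Γ(Γ(Z,X),Y): the
derivatives of the fields cancel by the symmetry of D²Z and the definition of the bracket
(`curvature_bilinear_family`). Hence R is a tensor.

For the formula, ∂ₓ undoes the primitive in Γ, so R(u,v)v is described by pointwise polynomials in
u₁ₓ, u₂, v₁ₓ, v₂ whose coefficients are means. In the integrand of 4⟨R(u,v)v,u⟩ all products of four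
pointwise values cancel. There remain means times quadratic expressions, and multiples of u₁ₓ and
u₂, which integrate to 0. With a = ∫v₂u₁ₓ and b = ∫u₂v₁ₓ one has ω = (a - b)/4; the mixed terms add
up to -¾(a - b)² = -12ω², the others to 4(⟨u,u⟩⟨v,v⟩ - ⟨u,v⟩²) (`metric_curvatureTensor`).

The metric is indefinite. If v crosses the null cone while ⟨u,v⟩ = 0 and ω(u,v) ≠ 0 stay fixed, the
denominator of sec tends to 0 with either sign, and the term -3ω² makes sec unbounded in both
directions (`exists_sec_eq`).

The analysis rests on Fourier series. For s > 1/2, H^s is complete, embeds in C(S¹) and is an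
algebra; once an operation is known to be well defined, the closed graph theorem makes it continuous
(`LinearMap.continuous_of_separating`). -/

noncomputable section

/-! ### Fourier coefficients and H^s as a weighted ℓ² condition -/

/-- The Fourier coefficients of a continuous real function on the circle. -/
def realFourier (f : C(UnitAddCircle, ℝ)) (k : ℤ) : ℂ := fourierCoeff (fun x => (f x : ℂ)) k

theorem integrable_ofReal_comp (f : C(UnitAddCircle, ℝ)) :
    MeasureTheory.Integrable (fun x => (f x : ℂ)) (AddCircle.haarAddCircle (T := 1)) :=
  (Complex.continuous_ofReal.comp f.continuous).integrable_of_hasCompactSupport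
    (HasCompactSupport.of_compactSpace _)

theorem realFourier_add (f g : C(UnitAddCircle, ℝ)) (k : ℤ) :
    realFourier (f + g) k = realFourier f k + realFourier g k := by
  have h := congrFun (fourierCoeff.add (integrable_ofReal_comp f) (integrable_ofReal_comp g)) k
  simp only [realFourier, Pi.add_apply] at h ⊢
  rw [← h]
  congr 1
  funext x
  simp

theorem realFourier_smul (c : ℝ) (f : C(UnitAddCircle, ℝ)) (k : ℤ) :
    realFourier (c • f) k = c • realFourier f k := by
  have h := fourierCoeff.const_mul (fun x : UnitAddCircle => (f x : ℂ)) (c : ℂ) k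
  simp only [realFourier, Complex.real_smul]
  rw [← h]
  congr 1
  funext x
  simp

theorem norm_fourierCoeff_le {f : UnitAddCircle → ℂ} {C : ℝ} (hf : ∀ x, ‖f x‖ ≤ C) (k : ℤ) :
    ‖fourierCoeff f k‖ ≤ C := by
  have h := MeasureTheory.norm_integral_le_of_norm_le_const
    (μ := AddCircle.haarAddCircle (T := 1)) (f := fun t => fourier (-k) t • f t) (C := C)
    (Filter.Eventually.of_forall fun x => by
      rw [norm_smul]
      have : ‖(fourier (-k) x : ℂ)‖ = 1 := by rw [fourier_apply]; exact Circle.norm_coe _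
      rw [this, one_mul]; exact hf x)
  simpa [fourierCoeff] using h

/-- The `k`-th Fourier coefficient as a continuous linear functional on `C(S¹)`. -/
def realFourierCLM (k : ℤ) : C(UnitAddCircle, ℝ) →L[ℝ] ℂ :=
  LinearMap.mkContinuous
    { toFun := fun f => realFourier f k
      map_add' := fun f g => realFourier_add f g k
      map_smul' := fun c f => realFourier_smul c f k } 1 fun f => by
    rw [one_mul]
    exact norm_fourierCoeff_le (fun x => by simpa using f.norm_coe_le_norm x) k

/-- The `k`-th Fourier coefficient as a continuous linear functional on complex functions. -/
def fourierCLM (k : ℤ) : C(UnitAddCircle, ℂ) →L[ℂ] ℂ :=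
  LinearMap.mkContinuous
    { toFun := fun f => fourierCoeff f k
      map_add' := fun f g => congrFun (fourierCoeff.add
        (f.continuous.integrable_of_hasCompactSupport (HasCompactSupport.of_compactSpace _))
        (g.continuous.integrable_of_hasCompactSupport (HasCompactSupport.of_compactSpace _))) k
      map_smul' := fun c f => fourierCoeff.const_smul f c k } 1 fun f => by
    rw [one_mul]
    exact norm_fourierCoeff_le (fun x => f.norm_coe_le_norm x) k

@[simp] theorem fourierCLM_apply (k : ℤ) (f : C(UnitAddCircle, ℂ)) :
    fourierCLM k f = fourierCoeff f k := rfl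

theorem fourierCoeff_fourier_eq (j k : ℤ) :
    fourierCoeff (fourier j : C(UnitAddCircle, ℂ)) k = if k = j then 1 else 0 := by
  rw [fourierCoeff_fourier]
  simp [Pi.single_apply]

theorem realFourier_neg (f : C(UnitAddCircle, ℝ)) (k : ℤ) :
    realFourier f (-k) = (starRingEnd ℂ) (realFourier f k) := by
  simp only [realFourier, fourierCoeff]
  rw [← integral_conj]
  congr 1
  funext x
  simp only [smul_eq_mul, map_mul, Complex.conj_ofReal]
  rw [← fourier_neg]

theorem realFourier_injective {f g : C(UnitAddCircle, ℝ)}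
    (h : ∀ k, realFourier f k = realFourier g k) : f = g := by
  apply weightedFourier_injective 0
  funext k
  have := h k
  simp only [realFourier] at this
  simp [weightedFourier, this]

theorem weight_pos (s : ℝ) (k : ℤ) : (0 : ℝ) < (1 + (k : ℝ) ^ 2) ^ s := by positivity

theorem sqrt_weight_sq (s : ℝ) (k : ℤ) :
    ((1 + (k : ℝ) ^ 2) ^ (s / 2)) ^ 2 = (1 + (k : ℝ) ^ 2) ^ s := by
  have h0 : (0 : ℝ) ≤ 1 + (k : ℝ) ^ 2 := by positivity
  generalize 1 + (k : ℝ) ^ 2 = w at h0 ⊢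
  rw [← Real.rpow_natCast, ← Real.rpow_mul h0]
  congr 1
  push_cast
  ring

theorem norm_weightedFourier_sq (s : ℝ) (f : C(UnitAddCircle, ℝ)) (k : ℤ) :
    ‖weightedFourier s f k‖ ^ 2 = (1 + (k : ℝ) ^ 2) ^ s * ‖realFourier f k‖ ^ 2 := by
  simp only [weightedFourier, realFourier, norm_mul, mul_pow, Complex.norm_real, Real.norm_eq_abs,
    sq_abs, sqrt_weight_sq]

theorem mem_sobolevSubmodule_iff {s : ℝ} {f : C(UnitAddCircle, ℝ)} :
    f ∈ sobolevSubmodule s ↔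
      Summable fun k : ℤ => (1 + (k : ℝ) ^ 2) ^ s * ‖realFourier f k‖ ^ 2 := by
  have : f ∈ sobolevSubmodule s ↔ Memℓp (weightedFourier s f) 2 := Iff.rfl
  rw [this, memℓp_gen_iff (by norm_num)]
  simp only [ENNReal.toReal_ofNat, Real.rpow_ofNat, norm_weightedFourier_sq]

theorem summable_weight_neg {s : ℝ} (hs : 1 / 2 < s) :
    Summable fun k : ℤ => (1 + (k : ℝ) ^ 2) ^ (-s) := by
  have h := Real.summable_abs_int_rpow (b := 2 * s) (by linarith)
  -- The comparison with |k|^(-2s) fails at k = 0, where the real power takes the value 0.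
  refine Summable.of_norm_bounded_eventually h ?_
  rw [Filter.eventually_cofinite]
  refine (Set.finite_singleton (0 : ℤ)).subset fun k hk => ?_
  by_contra hk0
  apply hk
  have hk1 : (0 : ℝ) < |(k : ℝ)| := by simpa using hk0
  rw [Real.norm_of_nonneg (weight_pos _ _).le]
  have : |(k : ℝ)| ^ (-(2 * s)) = ((k : ℝ) ^ 2) ^ (-s) := by
    rw [← sq_abs, ← Real.rpow_natCast, ← Real.rpow_mul hk1.le]
    congr 1; push_cast; ring
  rw [this]
  exact Real.rpow_le_rpow_of_nonpos (by rw [← sq_abs]; positivity) (by linarith) (by linarith)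

/-- From w⁻¹(wc - 1)² ≥ 0 follows 2c ≤ w⁻¹ + wc², and ∑ w⁻¹ converges because s > 1/2. This gives
absolutely convergent Fourier series in H^s. -/
theorem summable_of_summable_weight_mul_sq {s : ℝ} (hs : 1 / 2 < s) {c : ℤ → ℝ}
    (hc : ∀ k, 0 ≤ c k) (h : Summable fun k : ℤ => (1 + (k : ℝ) ^ 2) ^ s * c k ^ 2) :
    Summable c := by
  refine Summable.of_nonneg_of_le hc (fun k => ?_) ((summable_weight_neg hs).add h)
  have hw := weight_pos s k
  rw [Real.rpow_neg (by positivity)]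
  set w := (1 + (k : ℝ) ^ 2) ^ s
  have h1 : w * w⁻¹ = 1 := mul_inv_cancel₀ hw.ne'
  have h2 : 0 < w⁻¹ := by positivity
  nlinarith [mul_nonneg h2.le (sq_nonneg (w * c k - 1)), hc k, sq_nonneg (w * c k),
    mul_nonneg hw.le (sq_nonneg (c k))]

theorem summable_norm_realFourier {s : ℝ} (hs : 1 / 2 < s) {f : C(UnitAddCircle, ℝ)}
    (hf : f ∈ sobolevSubmodule s) : Summable fun k => ‖realFourier f k‖ :=
  summable_of_summable_weight_mul_sq hs (fun _ => norm_nonneg _) (mem_sobolevSubmodule_iff.mp hf)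

/-- A summable conjugation-symmetric sequence is the sequence of Fourier coefficients of a
continuous real function. -/
theorem exists_realFourier_eq {c : ℤ → ℂ} (hc : Summable fun k => ‖c k‖)
    (hsymm : ∀ k, c (-k) = (starRingEnd ℂ) (c k)) :
    ∃ f : C(UnitAddCircle, ℝ), ∀ k, realFourier f k = c k := by
  have hsum : Summable fun k => c k • (fourier k : C(UnitAddCircle, ℂ)) := by
    refine Summable.of_norm ?_
    simpa [norm_smul, fourier_norm] using hc
  set F := ∑' k, c k • (fourier k : C(UnitAddCircle, ℂ)) with hF
  have hFk : ∀ k, fourierCoeff F k = c k := by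
    intro k
    have h := (fourierCLM k).hasSum hsum.hasSum
    have h2 : HasSum (fun j => fourierCLM k (c j • (fourier j : C(UnitAddCircle, ℂ)))) (c k) := by
      have : (fun j => fourierCLM k (c j • (fourier j : C(UnitAddCircle, ℂ)))) =
          fun j => if j = k then c k else 0 := by
        funext j
        rw [map_smul, fourierCLM_apply, fourierCoeff_fourier_eq]
        by_cases hj : k = j
        · subst hj; simp
        · simp [hj, Ne.symm hj]
      rw [this]
      exact hasSum_ite_eq k (c k)
    exact h.unique h2
  have hpt : ∀ x, HasSum (fun k => c k * fourier k x) (F x) := fun x => by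
    simpa using (ContinuousMap.evalCLM ℂ x).hasSum hsum.hasSum
  -- Conjugating the series and substituting -k for k produce the same terms, by the symmetry of c.
  have hreal : ∀ x, ((F x).re : ℂ) = F x := by
    intro x
    refine Complex.conj_eq_iff_re.mp ?_
    have h1 := Complex.hasSum_conj'.mpr ((hpt x))
    have h2 := (Equiv.neg ℤ).hasSum_iff.mpr (hpt x)
    have h3 : ((fun k => c k * fourier k x) ∘ Equiv.neg ℤ) =
        fun k => (starRingEnd ℂ) (c k * fourier k x) := by
      funext k
      simp only [Function.comp_apply, Equiv.neg_apply, hsymm, fourier_neg, map_mul]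
    exact h1.unique (h3 ▸ h2)
  refine ⟨⟨fun x => (F x).re, Complex.continuous_re.comp F.continuous⟩, fun k => ?_⟩
  rw [← hFk k]
  simp only [realFourier, ContinuousMap.coe_mk, hreal]

/-! ### Completeness of H^s -/

namespace Sobolev

variable {s : ℝ}

theorem ext_toCont {f g : Sobolev s} (h : toCont f = toCont g) : f = g := Subtype.ext h

theorem toCont_eq_of_per {f : Sobolev s} {g : C(UnitAddCircle, ℝ)}
    (h : ∀ x : ℝ, per f x = g (x : UnitAddCircle)) : toCont f = g := by
  ext x
  induction x using QuotientAddGroup.induction_on with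
  | H x => exact h x

theorem ext_per {f g : Sobolev s} (h : ∀ x, per f x = per g x) : f = g :=
  ext_toCont (toCont_eq_of_per h)

@[simp] theorem per_add (f g : Sobolev s) (x : ℝ) : per (f + g) x = per f x + per g x := by
  simp [per]

@[simp] theorem per_sub (f g : Sobolev s) (x : ℝ) : per (f - g) x = per f x - per g x := by
  simp [per]

@[simp] theorem per_neg (f : Sobolev s) (x : ℝ) : per (-f) x = -per f x := by
  simp [per]

@[simp] theorem per_zero (x : ℝ) : per (0 : Sobolev s) x = 0 := by
  simp [per]

@[simp] theorem per_smul (c : ℝ) (f : Sobolev s) (x : ℝ) : per (c • f) x = c * per f x := by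
  simp [per]

@[simp] theorem per_one (x : ℝ) : per (one s) x = 1 := rfl

theorem continuous_per (f : Sobolev s) : Continuous (per f) :=
  (toCont f).continuous.comp (AddCircle.continuous_mk' 1)

theorem per_add_one (f : Sobolev s) (x : ℝ) : per f (x + 1) = per f x := by
  simp only [per]
  congr 1
  exact AddCircle.coe_add_period 1 x

theorem toCont_mem (f : Sobolev s) : toCont f ∈ sobolevSubmodule s := f.2

theorem exists_toCont_eq {f : C(UnitAddCircle, ℝ)} (hf : f ∈ sobolevSubmodule s) :
    ∃ g : Sobolev s, toCont g = f := ⟨⟨f, hf⟩, rfl⟩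

theorem norm_sobolevToLp (f : Sobolev s) : ‖sobolevToLp s f‖ = ‖f‖ := rfl

theorem isometry_sobolevToLp : Isometry (sobolevToLp s) :=
  AddMonoidHomClass.isometry_of_norm _ norm_sobolevToLp

theorem sobolevToLp_apply (f : Sobolev s) (k : ℤ) :
    sobolevToLp s f k =
      (((1 + (k : ℝ) ^ 2) ^ (s / 2) : ℝ) : ℂ) * realFourier (toCont f) k := rfl

theorem continuous_realFourier_toCont (k : ℤ) :
    Continuous fun f : Sobolev s => realFourier (toCont f) k := by
  have h1 : Continuous fun f : Sobolev s => sobolevToLp s f k := by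
    exact (lp.evalCLM ℂ (fun _ : ℤ => ℂ) 2 k).continuous.comp
      (isometry_sobolevToLp (s := s)).continuous
  have h2 : (fun f : Sobolev s => realFourier (toCont f) k) = fun f =>
      ((((1 + (k : ℝ) ^ 2) ^ (s / 2) : ℝ) : ℂ))⁻¹ * sobolevToLp s f k := by
    funext f
    have : ((((1 + (k : ℝ) ^ 2) ^ (s / 2) : ℝ) : ℂ)) ≠ 0 := by
      exact_mod_cast (weight_pos (s / 2) k).ne'
    rw [sobolevToLp_apply, inv_mul_cancel_left₀ this]
  rw [h2]
  exact continuous_const.mul h1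

/-- A conjugation-symmetric ℓ² sequence divided by the weights is summable for s > 1/2, hence comes
from a continuous real function. The symmetry is a closed condition, which yields completeness of
H^s. -/
theorem range_sobolevToLp (hs : 1 / 2 < s) :
    Set.range (sobolevToLp s) =
      {c | ∀ k : ℤ, c (-k) = (starRingEnd ℂ) (c k)} := by
  ext c
  constructor
  · rintro ⟨f, rfl⟩ k
    rw [sobolevToLp_apply, sobolevToLp_apply, realFourier_neg]
    simp
  · intro hc
    have hw : ∀ k : ℤ, ((((1 + (k : ℝ) ^ 2) ^ (s / 2) : ℝ) : ℂ)) ≠ 0 := fun k => by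
      exact_mod_cast (weight_pos (s / 2) k).ne'
    set d : ℤ → ℂ := fun k => ((((1 + (k : ℝ) ^ 2) ^ (s / 2) : ℝ) : ℂ))⁻¹ * c k with hd
    have hmul : ∀ k : ℤ, (((1 + (k : ℝ) ^ 2) ^ (s / 2) : ℝ) : ℂ) * d k = c k := fun k => by
      rw [hd]; exact mul_inv_cancel_left₀ (hw k) _
    have hnorm : ∀ k : ℤ, (1 + (k : ℝ) ^ 2) ^ s * ‖d k‖ ^ 2 = ‖c k‖ ^ 2 := by
      intro k
      refine Eq.trans ?_ (congrArg (fun z : ℂ => ‖z‖ ^ 2) (hmul k))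
      simp only [norm_mul, mul_pow, Complex.norm_real, Real.norm_eq_abs, sq_abs, sqrt_weight_sq]
    have hsum : Summable fun k : ℤ => (1 + (k : ℝ) ^ 2) ^ s * ‖d k‖ ^ 2 := by
      simp only [hnorm]
      have := (memℓp_gen_iff (p := 2) (by norm_num)).mp (lp.memℓp c)
      simpa using this
    obtain ⟨f, hf⟩ := exists_realFourier_eq (c := d)
      (summable_of_summable_weight_mul_sq hs (fun _ => norm_nonneg _) hsum) (fun k => by
        simp only [hd, hc k, map_mul, map_inv₀, Complex.conj_ofReal]
        push_cast
        simp)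
    have hmem : f ∈ sobolevSubmodule s := mem_sobolevSubmodule_iff.mpr (by simpa only [hf] using hsum)
    refine ⟨⟨f, hmem⟩, ?_⟩
    ext k
    refine (sobolevToLp_apply _ k).trans ?_
    exact (congrArg _ (hf k)).trans (hmul k)

theorem completeSpace (hs : 1 / 2 < s) : CompleteSpace (Sobolev s) := by
  rw [completeSpace_iff_isComplete_range (isometry_sobolevToLp (s := s)).isUniformInducing,
    range_sobolevToLp hs]
  refine IsClosed.isComplete ?_
  have he : ∀ k, Continuous fun c : lp (fun _ : ℤ => ℂ) 2 => c k := fun k =>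
    (lp.evalCLM ℂ (fun _ : ℤ => ℂ) 2 k).continuous
  have : {c : lp (fun _ : ℤ => ℂ) 2 | ∀ k : ℤ, c (-k) = (starRingEnd ℂ) (c k)} =
      ⋂ k : ℤ, {c | c (-k) = (starRingEnd ℂ) (c k)} := by
    ext; simp
  rw [this]
  exact isClosed_iInter fun k => isClosed_eq (he _) (Complex.continuous_conj.comp (he k))

end Sobolev

/-! ### Continuity from the closed graph theorem -/

/-- A linear map of Banach spaces is continuous if its compositions with the members of a
separating family of continuous functions are. -/
theorem LinearMap.continuous_of_separating {E F ι : Type*} [NormedAddCommGroup E] [NormedSpace ℝ E]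
    [CompleteSpace E] [NormedAddCommGroup F] [NormedSpace ℝ F] [CompleteSpace F]
    {G : ι → Type*} [∀ i, TopologicalSpace (G i)] [∀ i, T2Space (G i)]
    (T : E →ₗ[ℝ] F) (φ : ∀ i, F → G i) (hφ : ∀ i, Continuous (φ i))
    (hsep : ∀ a b, (∀ i, φ i a = φ i b) → a = b) (hT : ∀ i, Continuous fun e => φ i (T e)) :
    Continuous T := by
  -- If uₙ → x and T uₙ → y, then φᵢ(T uₙ) tends both to φᵢ(y) and to φᵢ(T x), so y = T x.
  refine T.continuous_of_seq_closed_graph fun u x y hu hTu => hsep _ _ fun i => ?_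
  exact tendsto_nhds_unique (((hφ i).tendsto y).comp hTu) (((hT i).tendsto x).comp hu)

namespace Sobolev

variable {s : ℝ}

theorem continuous_toCont (hs : 1 / 2 < s) : Continuous (toCont (s := s)) := by
  have := completeSpace hs
  exact toCont.continuous_of_separating (fun k f => realFourier f k)
    (fun k => (realFourierCLM k).continuous) (fun _ _ h => realFourier_injective h)
    continuous_realFourier_toCont

theorem continuous_per_apply (hs : 1 / 2 < s) (x : ℝ) : Continuous fun f : Sobolev s => per f x :=
  (ContinuousEvalConst.continuous_eval_const (x : UnitAddCircle)).comp (continuous_toCont hs)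

end Sobolev

/-! ### Products -/

theorem fourierCoeff_mul_fourier (F : C(UnitAddCircle, ℂ)) (j k : ℤ) :
    fourierCoeff (F * fourier j : C(UnitAddCircle, ℂ)) k = fourierCoeff F (k - j) := by
  simp only [fourierCoeff]
  congr 1
  funext x
  have : -(k - j) = -k + j := by ring
  rw [this, fourier_add]
  simp only [ContinuousMap.mul_apply, smul_eq_mul]
  ring

/-- The Fourier coefficients of a product are the convolution of the Fourier coefficients. -/
theorem hasSum_realFourier_mul (f g : C(UnitAddCircle, ℝ))
    (hg : Summable fun k => ‖realFourier g k‖) (k : ℤ) :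
    HasSum (fun j => realFourier g j * realFourier f (k - j)) (realFourier (f * g) k) := by
  let F : C(UnitAddCircle, ℂ) := ⟨fun x => (f x : ℂ), Complex.continuous_ofReal.comp f.continuous⟩
  let G : C(UnitAddCircle, ℂ) := ⟨fun x => (g x : ℂ), Complex.continuous_ofReal.comp g.continuous⟩
  have hG : HasSum (fun j => fourierCoeff G j • (fourier j : C(UnitAddCircle, ℂ))) G :=
    hasSum_fourier_series_of_summable hg.of_norm
  -- Multiplication by f followed by the k-th coefficient is a continuous functional, so it applies
  -- termwise to the uniformly convergent series of g.
  have h := ((fourierCLM k).comp (ContinuousLinearMap.mul ℂ C(UnitAddCircle, ℂ) F)).hasSum hG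
  have e1 : ((fourierCLM k).comp (ContinuousLinearMap.mul ℂ C(UnitAddCircle, ℂ) F)) G =
      realFourier (f * g) k := by
    simp only [ContinuousLinearMap.comp_apply, ContinuousLinearMap.mul_apply', fourierCLM_apply,
      realFourier]
    congr 1
    funext x
    simp [F, G]
  rw [e1] at h
  have e2 : (fun j => realFourier g j * realFourier f (k - j)) = fun j =>
      ((fourierCLM k).comp (ContinuousLinearMap.mul ℂ C(UnitAddCircle, ℂ) F))
        (fourierCoeff G j • (fourier j : C(UnitAddCircle, ℂ))) := by
    funext j
    rw [map_smul, smul_eq_mul]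
    congr 1
    exact (fourierCoeff_mul_fourier F j k).symm
  rw [e2]
  exact h

/-- Young's inequality `ℓ¹ * ℓ² ⊆ ℓ²`. -/
theorem exists_lp_hasSum_convolution {b A : ℤ → ℝ} (hb0 : ∀ k, 0 ≤ b k) (hb : Summable b)
    (hA : Summable fun k => A k ^ 2) :
    ∃ S : lp (fun _ : ℤ => ℝ) 2, ∀ k, HasSum (fun j => b j * A (k - j)) (S k) := by
  have hmem : ∀ j : ℤ, Memℓp (E := fun _ : ℤ => ℝ) (fun k => A (k - j)) 2 := fun j => by
    rw [memℓp_gen_iff (by norm_num)]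
    have := ((Equiv.subRight j).summable_iff (f := fun k => A k ^ 2)).mpr hA
    simpa [Function.comp_def] using this
  let v : ℤ → lp (fun _ : ℤ => ℝ) 2 := fun j => ⟨fun k => A (k - j), hmem j⟩
  -- Translations are isometries of ℓ², so ∑ b j • v j converges absolutely there.
  have hv : ∀ j, ‖v j‖ = ‖v 0‖ := fun j => by
    rw [lp.norm_eq_tsum_rpow (by norm_num), lp.norm_eq_tsum_rpow (by norm_num)]
    congr 1
    simpa [v] using (Equiv.subRight j).tsum_eq fun k => ‖A k‖ ^ (2 : ENNReal).toReal
  have hsum : Summable fun j => b j • v j := by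
    refine Summable.of_norm ?_
    have : (fun j => ‖b j • v j‖) = fun j => b j * ‖v 0‖ := by
      funext j
      rw [norm_smul, hv, Real.norm_of_nonneg (hb0 j)]
    rw [this]
    exact hb.mul_right _
  exact ⟨∑' j, b j • v j, fun k =>
    (lp.evalCLM ℝ (fun _ : ℤ => ℝ) 2 k).hasSum hsum.hasSum⟩

/-- Writing k = j + (k - j) gives k² ≤ 4 max(j², (k - j)²); the larger of the two weights already
suffices. -/
theorem weight_le_weight_add_weight {s : ℝ} (hs : 0 ≤ s) (j k : ℤ) :
    (1 + (k : ℝ) ^ 2) ^ s ≤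
      4 ^ s * ((1 + (j : ℝ) ^ 2) ^ s + (1 + ((k - j : ℤ) : ℝ) ^ 2) ^ s) := by
  have key : ∀ x y : ℝ, 0 ≤ x → x ≤ y → 1 + (k : ℝ) ^ 2 ≤ 4 * (1 + y) →
      (1 + (k : ℝ) ^ 2) ^ s ≤ 4 ^ s * (1 + y) ^ s := fun x y hx hxy h => by
    rw [← Real.mul_rpow (by norm_num) (by linarith)]
    exact Real.rpow_le_rpow (by positivity) h hs
  have h1 := weight_pos s j
  have h2 := weight_pos s (k - j)
  have h4 : (0 : ℝ) < 4 ^ s := by positivity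
  rw [mul_add]
  have hk : (k : ℝ) = j + ((k - j : ℤ) : ℝ) := by push_cast; ring
  set x := ((k - j : ℤ) : ℝ)
  rcases le_total (x ^ 2) ((j : ℝ) ^ 2) with h | h
  · have := key _ _ (sq_nonneg _) h (by rw [hk]; nlinarith [sq_nonneg ((j : ℝ) - x)])
    nlinarith [mul_pos h4 h2]
  · have := key _ _ (sq_nonneg _) h (by rw [hk]; nlinarith [sq_nonneg ((j : ℝ) - x)])
    nlinarith [mul_pos h4 h1]

/-- Splitting the weight by `weight_le_weight_add_weight` bounds the weighted coefficients of the
product by two convolutions, each of an ℓ¹ sequence with a weighted ℓ² sequence, and Young's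
inequality applies to both. -/
theorem mul_mem_sobolevSubmodule {s : ℝ} (hs : 1 / 2 < s) {f g : C(UnitAddCircle, ℝ)}
    (hf : f ∈ sobolevSubmodule s) (hg : g ∈ sobolevSubmodule s) : f * g ∈ sobolevSubmodule s := by
  set W : ℤ → ℝ := fun k => (1 + (k : ℝ) ^ 2) ^ (s / 2) with hW
  have hW0 : ∀ k, 0 < W k := fun k => weight_pos _ k
  have hsq : ∀ {h : C(UnitAddCircle, ℝ)} (k : ℤ),
      (1 + (k : ℝ) ^ 2) ^ s * ‖realFourier h k‖ ^ 2 = (W k * ‖realFourier h k‖) ^ 2 := fun k => by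
    rw [mul_pow, hW, sqrt_weight_sq]
  have hf2 := mem_sobolevSubmodule_iff.mp hf
  have hg2 := mem_sobolevSubmodule_iff.mp hg
  simp only [hsq] at hf2 hg2
  have hf1 := summable_norm_realFourier hs hf
  have hg1 := summable_norm_realFourier hs hg
  obtain ⟨S, hS⟩ := exists_lp_hasSum_convolution (fun _ => norm_nonneg _) hg1 hf2
  obtain ⟨T, hT⟩ := exists_lp_hasSum_convolution (fun _ => norm_nonneg _) hf1 hg2
  rw [mem_sobolevSubmodule_iff]
  simp only [hsq]
  have hST := (memℓp_gen_iff (by norm_num)).mp (lp.memℓp ((4 ^ (s / 2) : ℝ) • (S + T)))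
  simp only [ENNReal.toReal_ofNat, Real.rpow_ofNat] at hST
  refine hST.of_nonneg_of_le (fun k => sq_nonneg _) fun k => ?_
  refine pow_le_pow_left₀ (mul_nonneg (hW0 k).le (norm_nonneg _)) ?_ 2
  refine le_trans ?_ (le_abs_self _)
  -- Substituting k - j for j lets both convolutions be summed over the same index as the
  -- coefficients of f * g.
  have hT' : HasSum (fun j => ‖realFourier f (k - j)‖ * (W j * ‖realFourier g j‖)) (T k) := by
    have := (Equiv.subLeft k).hasSum_iff.mpr (hT k)
    simpa [Function.comp_def] using this
  have hsum := ((hS k).add hT').mul_left (4 ^ (s / 2) : ℝ)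
  have hprod := (hasSum_realFourier_mul f g hg1 k)
  have h1 : Summable fun j => ‖realFourier g j * realFourier f (k - j)‖ := by
    refine Summable.of_nonneg_of_le (fun _ => norm_nonneg _) (fun j => ?_) (hS k).summable
    rw [norm_mul]
    have : 1 ≤ W (k - j) := Real.one_le_rpow (by nlinarith [sq_nonneg ((k - j : ℤ) : ℝ)]) (by linarith)
    have h2 : (0 : ℝ) ≤ ‖realFourier f (k - j)‖ := norm_nonneg _
    exact mul_le_mul_of_nonneg_left (by nlinarith) (norm_nonneg _)
  rw [← hprod.tsum_eq]
  calc W k * ‖∑' j, realFourier g j * realFourier f (k - j)‖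
      ≤ W k * ∑' j, ‖realFourier g j * realFourier f (k - j)‖ :=
        mul_le_mul_of_nonneg_left (norm_tsum_le_tsum_norm h1) (hW0 k).le
    _ = ∑' j, W k * ‖realFourier g j * realFourier f (k - j)‖ := (tsum_mul_left).symm
    _ ≤ ∑' j, 4 ^ (s / 2) * (‖realFourier g j‖ * (W (k - j) * ‖realFourier f (k - j)‖) +
          ‖realFourier f (k - j)‖ * (W j * ‖realFourier g j‖)) := by
        refine (h1.mul_left _).tsum_le_tsum (fun j => ?_) hsum.summable
        have h := weight_le_weight_add_weight (s := s / 2) (by linarith) j k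
        rw [norm_mul]
        have h3 := mul_le_mul_of_nonneg_right h
          (mul_nonneg (norm_nonneg (realFourier g j)) (norm_nonneg (realFourier f (k - j))))
        refine h3.trans (le_of_eq ?_)
        simp only [hW]
        ring
    _ = _ := hsum.tsum_eq

/-! ### Primitives -/

theorem exists_circle_eq {f : ℝ → ℝ} (hc : Continuous f) (hp : Function.Periodic f 1) :
    ∃ g : C(UnitAddCircle, ℝ), ∀ x : ℝ, g (x : UnitAddCircle) = f x :=
  ⟨⟨hp.lift, continuous_coinduced_dom.mpr hc⟩, fun x => hp.lift_coe x⟩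

theorem realFourier_eq_fourierCoeffOn (g : C(UnitAddCircle, ℝ)) (k : ℤ) :
    realFourier g k = fourierCoeffOn (zero_lt_one (α := ℝ))
      (fun x : ℝ => ((g (x : UnitAddCircle) : ℝ) : ℂ)) k := by
  rw [realFourier, fourierCoeff_eq_intervalIntegral _ _ 0, fourierCoeffOn_eq_integral]
  simp only [fourier_coe_apply, zero_add, sub_zero]

/-- Fourier coefficients of a continuously differentiable function in terms of its derivative. -/
theorem realFourier_deriv {f g : C(UnitAddCircle, ℝ)}
    (h : ∀ x : ℝ, HasDerivAt (fun y : ℝ => f (y : UnitAddCircle)) (g (x : UnitAddCircle)) x)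
    {k : ℤ} (hk : k ≠ 0) :
    realFourier g k = 2 * Real.pi * Complex.I * k * realFourier f k := by
  have hgc : Continuous fun x : ℝ => ((g (x : UnitAddCircle) : ℝ) : ℂ) :=
    Complex.continuous_ofReal.comp (g.continuous.comp (AddCircle.continuous_mk' 1))
  have h1 := fourierCoeffOn_of_hasDerivAt (zero_lt_one (α := ℝ)) hk
    (f := fun x : ℝ => ((f (x : UnitAddCircle) : ℝ) : ℂ))
    (f' := fun x : ℝ => ((g (x : UnitAddCircle) : ℝ) : ℂ))
    (fun x _ => (h x).ofReal_comp) (hgc.intervalIntegrable 0 1)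
  rw [← realFourier_eq_fourierCoeffOn, ← realFourier_eq_fourierCoeffOn] at h1
  -- The boundary terms of the integration by parts cancel because 0 and 1 are the same point of the
  -- circle.
  have h2 : ((1 : ℝ) : UnitAddCircle) = ((0 : ℝ) : UnitAddCircle) := by
    simp
  rw [h1, h2]
  have hpi : (Real.pi : ℂ) ≠ 0 := by exact_mod_cast Real.pi_ne_zero
  have hk' : (k : ℂ) ≠ 0 := by exact_mod_cast hk
  have hI := Complex.I_ne_zero
  field_simp
  simp

/-- For k ≠ 0 the derivative multiplies the coefficient by 2πik, and 1 + k² ≤ 4π²k² absorbs the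
missing power of the weight. The single frequency 0 does not affect summability. -/
theorem memSobolev_of_hasDerivAt {s : ℝ} {f g : C(UnitAddCircle, ℝ)}
    (h : ∀ x : ℝ, HasDerivAt (fun y : ℝ => f (y : UnitAddCircle)) (g (x : UnitAddCircle)) x)
    (hg : g ∈ sobolevSubmodule (s - 1)) : f ∈ sobolevSubmodule s := by
  rw [mem_sobolevSubmodule_iff] at hg ⊢
  refine Summable.of_norm_bounded_eventually hg ?_
  rw [Filter.eventually_cofinite]
  refine (Set.finite_singleton (0 : ℤ)).subset fun k hk => ?_
  by_contra hk0
  apply hk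
  have hk1 : k ≠ 0 := hk0
  have hw : (0 : ℝ) < 1 + (k : ℝ) ^ 2 := by positivity
  have hk2 : (1 : ℝ) ≤ (k : ℝ) ^ 2 := by
    exact_mod_cast (show 1 ≤ k ^ 2 by have := sq_nonneg k; have := pow_ne_zero 2 hk1; omega)
  rw [Real.norm_of_nonneg (by positivity), realFourier_deriv h hk1, Real.rpow_sub_one hw.ne']
  simp only [norm_mul, Complex.norm_I, Complex.norm_intCast, Complex.norm_real, Complex.norm_ofNat,
    Real.norm_of_nonneg Real.pi_pos.le, mul_pow, sq_abs, one_pow]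
  have hW := weight_pos s k
  set W := (1 + (k : ℝ) ^ 2) ^ s
  have hn : 0 ≤ W * ‖realFourier f k‖ ^ 2 := by positivity
  have h3 : 1 + (k : ℝ) ^ 2 ≤ 2 ^ 2 * Real.pi ^ 2 * 1 * (k : ℝ) ^ 2 := by
    have : 9 ≤ Real.pi ^ 2 := by nlinarith [Real.pi_gt_three]
    nlinarith
  rw [div_mul_eq_mul_div, le_div_iff₀ hw]
  nlinarith [mul_le_mul_of_nonneg_left h3 hn]

namespace Sobolev

variable {s : ℝ}

theorem toCont_coe (f : Sobolev s) (x : ℝ) : toCont f (x : UnitAddCircle) = per f x := rfl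

theorem mean_add (f g : Sobolev s) : mean (f + g) = mean f + mean g := by
  unfold mean
  rw [← intervalIntegral.integral_add (intervalIntegrable_per f) (intervalIntegrable_per g)]
  simp

theorem mean_smul (c : ℝ) (f : Sobolev s) : mean (c • f) = c * mean f := by
  unfold mean
  rw [← intervalIntegral.integral_const_mul]
  simp

theorem mean_one : mean (one s) = 1 := by simp [mean]

theorem realFourier_toCont_zero (f : Sobolev s) : realFourier (toCont f) 0 = (mean f : ℂ) := by
  rw [realFourier_eq_fourierCoeffOn, fourierCoeffOn_eq_integral, mean,
    ← intervalIntegral.integral_ofReal]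
  simp [toCont_coe]

/-- The primitive of g grows by its mean over each period; the linear correction removes this
growth. -/
theorem periodic_primitive (g : Sobolev s) :
    Function.Periodic (fun x => (∫ y in (0 : ℝ)..x, per g y) - x * mean g) 1 := by
  intro x
  have hi : ∀ a b, IntervalIntegrable (per g) MeasureTheory.volume a b := fun a b =>
    (continuous_per g).intervalIntegrable a b
  have hp : Function.Periodic (per g) 1 := per_add_one g
  have h1 := hp.intervalIntegral_add_eq x 0
  have h2 := intervalIntegral.integral_add_adjacent_intervals (hi 0 x) (hi x (x + 1))
  simp only
  rw [← h2, h1, zero_add]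
  simp only [mean]
  ring

theorem hasDerivAt_primitive (g : Sobolev s) (x : ℝ) :
    HasDerivAt (fun x => (∫ y in (0 : ℝ)..x, per g y) - x * mean g) (per g x - mean g) x := by
  have h1 := (continuous_per g).integral_hasStrictDerivAt 0 x
  have h2 := h1.hasDerivAt.sub ((hasDerivAt_id x).mul_const (mean g))
  rw [one_mul] at h2
  exact h2

theorem exists_primitive (g : Sobolev (s - 1)) :
    ∃ f : vanishing s, ∀ x, per f.1 x = (∫ y in (0 : ℝ)..x, per g y) - x * mean g := by
  obtain ⟨f, hf⟩ := exists_circle_eq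
    (continuous_iff_continuousAt.mpr fun x => (hasDerivAt_primitive g x).continuousAt)
    (periodic_primitive g)
  have hmem : f ∈ sobolevSubmodule s := by
    refine memSobolev_of_hasDerivAt (g := toCont (g - mean g • one _)) (fun x => ?_) (toCont_mem _)
    simp only [hf, toCont_coe, per_sub, per_smul, per_one, mul_one]
    exact hasDerivAt_primitive g x
  obtain ⟨F, hF⟩ := exists_toCont_eq hmem
  have hper : ∀ x, per F x = (∫ y in (0 : ℝ)..x, per g y) - x * mean g := fun x => by
    rw [← toCont_coe, hF, hf]
  exact ⟨⟨F, (hper 0).trans (by simp)⟩, hper⟩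

/-- The derivative is built on the Fourier side: 2πik f̂(k) satisfies the weighted ℓ² condition of
order s - 1 > 1/2, so it comes from a continuous g. The primitive of g has the coefficients of f for
k ≠ 0, so it differs from f by a constant. -/
theorem exists_deriv (hs : 3 / 2 < s) (f : Sobolev s) :
    ∃ g : Sobolev (s - 1), ∀ x, HasDerivAt (per f) (per g x) x := by
  have hsymm : ∀ k : ℤ, 2 * Real.pi * Complex.I * ((-k : ℤ) : ℂ) * realFourier (toCont f) (-k) =
      (starRingEnd ℂ) (2 * Real.pi * Complex.I * k * realFourier (toCont f) k) := fun k => by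
    rw [realFourier_neg]
    simp [Complex.conj_ofNat]
  have hsum : Summable fun k : ℤ => (1 + (k : ℝ) ^ 2) ^ (s - 1) *
      ‖2 * Real.pi * Complex.I * k * realFourier (toCont f) k‖ ^ 2 := by
    refine Summable.of_nonneg_of_le (fun k => by positivity) (fun k => ?_)
      ((mem_sobolevSubmodule_iff.mp (toCont_mem f)).mul_left (4 * Real.pi ^ 2))
    have hw : (0 : ℝ) < 1 + (k : ℝ) ^ 2 := by positivity
    rw [Real.rpow_sub_one hw.ne']
    simp only [norm_mul, Complex.norm_I, Complex.norm_intCast, Complex.norm_real,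
      Complex.norm_ofNat, Real.norm_of_nonneg Real.pi_pos.le, mul_pow, sq_abs, one_pow]
    have hW := weight_pos s k
    set W := (1 + (k : ℝ) ^ 2) ^ s
    have hn : 0 ≤ W * ‖realFourier (toCont f) k‖ ^ 2 * Real.pi ^ 2 := by positivity
    rw [div_mul_eq_mul_div, div_le_iff₀ hw]
    nlinarith
  obtain ⟨g, hg⟩ := exists_realFourier_eq (summable_of_summable_weight_mul_sq (by linarith)
    (fun _ => norm_nonneg _) hsum) hsymm
  have hmem : g ∈ sobolevSubmodule (s - 1) :=
    mem_sobolevSubmodule_iff.mpr (by simpa only [hg] using hsum)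
  obtain ⟨G, rfl⟩ := exists_toCont_eq hmem
  have hmean : mean G = 0 := by
    have h0 := hg 0
    rw [realFourier_toCont_zero] at h0
    simpa using h0
  obtain ⟨P, hP⟩ := exists_primitive G
  have hPd : ∀ x, HasDerivAt (per P.1) (per G x) x := fun x => by
    have := hasDerivAt_primitive G x
    rw [← funext hP, hmean, sub_zero] at this
    exact this
  obtain ⟨c, hc⟩ : ∃ c : ℝ, ∀ k, realFourier (toCont (P.1 + c • one s)) k =
      realFourier (toCont f) k := by
    refine ⟨mean f - mean P.1, fun k => ?_⟩
    by_cases hk : k = 0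
    · subst hk
      rw [realFourier_toCont_zero, realFourier_toCont_zero, mean_add, mean_smul, mean_one]
      congr 1
      ring
    · have hd : ∀ x : ℝ, HasDerivAt
          (fun y : ℝ => toCont (P.1 + (mean f - mean P.1) • one s) (y : UnitAddCircle))
          (toCont G (x : UnitAddCircle)) x := fun x => by
        simp only [toCont_coe, per_add, per_smul, per_one]
        exact (hPd x).add_const _
      have h1 := realFourier_deriv hd hk
      rw [hg] at h1
      have hk' : (2 * Real.pi * Complex.I * k : ℂ) ≠ 0 := by
        have hpi : (Real.pi : ℂ) ≠ 0 := by exact_mod_cast Real.pi_ne_zero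
        have hk' : (k : ℂ) ≠ 0 := by exact_mod_cast hk
        simp [hk', hpi]
      exact (mul_left_cancel₀ hk' h1).symm
  have hfP : P.1 + c • one s = f := ext_toCont (realFourier_injective hc)
  refine ⟨G, fun x => ?_⟩
  rw [← hfP]
  have : per (P.1 + c • one s) = fun x => per P.1 x + c := by funext x; simp
  rw [this]
  exact (hPd x).add_const c

end Sobolev

/-! ### Mean, product, derivative and primitive as continuous linear maps -/

namespace Sobolev

variable {s : ℝ}

theorem continuous_mean : Continuous (mean : Sobolev s → ℝ) := by
  have : (mean : Sobolev s → ℝ) = fun f => (realFourier (toCont f) 0).re := by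
    funext f
    rw [realFourier_toCont_zero, Complex.ofReal_re]
  rw [this]
  exact Complex.continuous_re.comp (continuous_realFourier_toCont 0)

/-- The mean value as a continuous linear functional. -/
def meanCLM (s : ℝ) : Sobolev s →L[ℝ] ℝ where
  toFun := mean
  map_add' := mean_add
  map_smul' := mean_smul
  cont := continuous_mean

@[simp] theorem meanCLM_apply (f : Sobolev s) : meanCLM s f = mean f := rfl

theorem exists_mul (hs : 1 / 2 < s) (f g : Sobolev s) :
    ∃ h : Sobolev s, ∀ x, per h x = per f x * per g x := by
  obtain ⟨h, hh⟩ := exists_toCont_eq (mul_mem_sobolevSubmodule hs (toCont_mem f) (toCont_mem g))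
  exact ⟨h, fun x => by rw [← toCont_coe, hh]; rfl⟩

/-- The product of two functions in `H^s(S¹)`, `s > 1/2`. -/
def mulFun (hs : 1 / 2 < s) (f g : Sobolev s) : Sobolev s := (exists_mul hs f g).choose

theorem per_mulFun (hs : 1 / 2 < s) (f g : Sobolev s) (x : ℝ) :
    per (mulFun hs f g) x = per f x * per g x := (exists_mul hs f g).choose_spec x

/-- Multiplication by `f` as a linear map. -/
def mulLinear (hs : 1 / 2 < s) (f : Sobolev s) : Sobolev s →ₗ[ℝ] Sobolev s where
  toFun := mulFun hs f
  map_add' g h := ext_per fun x => by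
    simp only [per_add, per_mulFun]; ring
  map_smul' c g := ext_per fun x => by
    simp only [per_smul, per_mulFun, RingHom.id_apply]; ring

theorem per_mulLinear (hs : 1 / 2 < s) (f g : Sobolev s) (x : ℝ) :
    per (mulLinear hs f g) x = per f x * per g x := per_mulFun hs f g x

/-- Multiplication by `f` as a continuous linear map. -/
def mulLeft (hs : 1 / 2 < s) (f : Sobolev s) : Sobolev s →L[ℝ] Sobolev s where
  toLinearMap := mulLinear hs f
  cont := by
    have := completeSpace hs
    refine (mulLinear hs f).continuous_of_separating (G := fun _ : ℝ => ℝ)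
      (fun x g => per g x) (continuous_per_apply hs) (fun _ _ => ext_per) fun x => ?_
    simp only [per_mulLinear]
    exact continuous_const.mul (continuous_per_apply hs x)

theorem per_mulLeft (hs : 1 / 2 < s) (f g : Sobolev s) (x : ℝ) :
    per (mulLeft hs f g) x = per f x * per g x := per_mulFun hs f g x

/-- Multiplication as a linear map into the continuous linear maps. -/
def mulLeftLinear (hs : 1 / 2 < s) : Sobolev s →ₗ[ℝ] Sobolev s →L[ℝ] Sobolev s where
  toFun := mulLeft hs
  map_add' f g := by
    ext1 h
    exact ext_per fun x => by
      simp only [per_mulLeft, per_add, add_apply]; ring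
  map_smul' c f := by
    ext1 h
    exact ext_per fun x => by
      simp only [per_mulLeft, per_smul, smul_apply, RingHom.id_apply]; ring

theorem per_mulLeftLinear (hs : 1 / 2 < s) (f g : Sobolev s) (x : ℝ) :
    per (mulLeftLinear hs f g) x = per f x * per g x := per_mulFun hs f g x

/-- Multiplication on `H^s(S¹)`, `s > 1/2`, as a continuous bilinear map. -/
def mul (hs : 1 / 2 < s) : Sobolev s →L[ℝ] Sobolev s →L[ℝ] Sobolev s where
  toLinearMap := mulLeftLinear hs
  cont := by
    have := completeSpace hs
    -- Operators L are separated by the numbers (L f)(x), so boundedness in the first factor needs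
    -- only pointwise continuity.
    refine (mulLeftLinear hs).continuous_of_separating (G := fun _ : Sobolev s × ℝ => ℝ)
      (fun i L => per (L i.1) i.2) (fun i => ?_) (fun L M h => ?_) fun i => ?_
    · exact (continuous_per_apply hs i.2).comp (ContinuousLinearMap.apply ℝ _ i.1).continuous
    · ext1 f
      exact ext_per fun x => h (f, x)
    · simp only [per_mulLeftLinear]
      exact (continuous_per_apply hs i.2).mul continuous_const

@[simp] theorem per_mul (hs : 1 / 2 < s) (f g : Sobolev s) (x : ℝ) :
    per (mul hs f g) x = per f x * per g x := per_mulLeft hs f g x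

theorem mul_one_left (hs : 1 / 2 < s) : mul hs (one s) = 1 := by
  ext1 f
  exact ext_per fun x => by simp

/-- The derivative of a function in `H^s(S¹)`, `s > 3/2`. -/
def derivFun (hs : 3 / 2 < s) (f : Sobolev s) : Sobolev (s - 1) := (exists_deriv hs f).choose

theorem hasDerivAt_derivFun (hs : 3 / 2 < s) (f : Sobolev s) (x : ℝ) :
    HasDerivAt (per f) (per (derivFun hs f) x) x := (exists_deriv hs f).choose_spec x

theorem mean_derivFun (hs : 3 / 2 < s) (f : Sobolev s) : mean (derivFun hs f) = 0 := by
  rw [mean, intervalIntegral.integral_eq_sub_of_hasDerivAt (fun x _ => hasDerivAt_derivFun hs f x)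
    (intervalIntegrable_per _), sub_eq_zero]
  simpa using per_add_one f 0

/-- Differentiation as a linear map. -/
def derivLinear (hs : 3 / 2 < s) : Sobolev s →ₗ[ℝ] Sobolev (s - 1) where
  toFun := derivFun hs
  map_add' f g := ext_per fun x => by
    have h := hasDerivAt_derivFun hs (f + g) x
    rw [show per (f + g) = per f + per g from funext (per_add f g)] at h
    rw [per_add]
    exact h.unique ((hasDerivAt_derivFun hs f x).add (hasDerivAt_derivFun hs g x))
  map_smul' c f := ext_per fun x => by
    have h := hasDerivAt_derivFun hs (c • f) x
    rw [show per (c • f) = fun x => c * per f x from funext (per_smul c f)] at h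
    rw [RingHom.id_apply, per_smul]
    exact h.unique ((hasDerivAt_derivFun hs f x).const_mul c)

/-- Differentiation `H^s(S¹) → H^(s-1)(S¹)`, for `s > 3/2`. -/
def derivCLM (hs : 3 / 2 < s) : Sobolev s →L[ℝ] Sobolev (s - 1) where
  toLinearMap := derivLinear hs
  cont := by
    have := completeSpace (s := s) (by linarith)
    have := completeSpace (s := s - 1) (by linarith)
    refine (derivLinear hs).continuous_of_separating (G := fun _ : ℤ => ℂ)
      (fun k f => realFourier (toCont f) k) continuous_realFourier_toCont
      (fun _ _ h => ext_toCont (realFourier_injective h)) fun k => ?_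
    have : (fun f : Sobolev s => realFourier (toCont (derivLinear hs f)) k) =
        fun f => 2 * Real.pi * Complex.I * k * realFourier (toCont f) k := by
      funext f
      -- `realFourier_deriv` excludes k = 0; there both sides vanish, as the derivative of a
      -- periodic function has zero mean.
      by_cases hk : k = 0
      · subst hk
        rw [realFourier_toCont_zero, show mean (derivLinear hs f) = 0 from mean_derivFun hs f]
        simp
      · exact realFourier_deriv (f := toCont f) (hasDerivAt_derivFun hs f) hk
    rw [this]
    exact continuous_const.mul (continuous_realFourier_toCont k)

theorem hasDerivAt_per (hs : 3 / 2 < s) (f : Sobolev s) (x : ℝ) :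
    HasDerivAt (per f) (per (derivCLM hs f) x) x := hasDerivAt_derivFun hs f x

theorem deriv_per (hs : 3 / 2 < s) (f : Sobolev s) : deriv (per f) = per (derivCLM hs f) :=
  funext fun x => (hasDerivAt_per hs f x).deriv

theorem contDiff_per (hs : 3 / 2 < s) (f : Sobolev s) : ContDiff ℝ 1 (per f) := by
  rw [contDiff_one_iff_deriv, deriv_per hs]
  exact ⟨fun x => (hasDerivAt_per hs f x).differentiableAt, continuous_per _⟩

theorem mean_derivCLM (hs : 3 / 2 < s) (f : Sobolev s) : mean (derivCLM hs f) = 0 :=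
  mean_derivFun hs f

theorem isClosed_vanishing (hs : 1 / 2 < s) : IsClosed (vanishing s : Set (Sobolev s)) :=
  isClosed_singleton.preimage (continuous_per_apply hs 0)

/-- The primitive of `g - ∫ g` that vanishes at `0`. -/
def primitiveFun (g : Sobolev (s - 1)) : vanishing s := (exists_primitive g).choose

theorem per_primitiveFun (g : Sobolev (s - 1)) (x : ℝ) :
    per (primitiveFun g).1 x = (∫ y in (0 : ℝ)..x, per g y) - x * mean g :=
  (exists_primitive g).choose_spec x

theorem derivCLM_primitiveFun (hs : 3 / 2 < s) (g : Sobolev (s - 1)) :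
    derivCLM hs (primitiveFun g).1 = g - mean g • one _ := ext_per fun x => by
  have h := hasDerivAt_per hs (primitiveFun g).1 x
  rw [funext (per_primitiveFun g)] at h
  rw [h.unique (hasDerivAt_primitive g x)]
  simp

/-- The linear map `g ↦ ∫₀ˣ (g - ∫ g)`. -/
def primitiveLinear (s : ℝ) : Sobolev (s - 1) →ₗ[ℝ] vanishing s where
  toFun := primitiveFun
  map_add' f g := Subtype.ext <| ext_per fun x => by
    simp only [Submodule.coe_add, per_add, per_primitiveFun, mean_add]
    rw [intervalIntegral.integral_add ((continuous_per f).intervalIntegrable _ _)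
      ((continuous_per g).intervalIntegrable _ _)]
    ring
  map_smul' c g := Subtype.ext <| ext_per fun x => by
    simp only [Submodule.coe_smul, per_smul, per_primitiveFun, mean_smul,
      RingHom.id_apply, intervalIntegral.integral_const_mul]
    ring

theorem vanishing_eq_of_derivCLM_eq (hs : 3 / 2 < s) {a b : vanishing s}
    (h : derivCLM hs a.1 = derivCLM hs b.1) : a = b := by
  refine Subtype.ext <| ext_per fun x => ?_
  have h1 : ∀ y, HasDerivAt (fun y => per a.1 y - per b.1 y) 0 y := fun y => by
    have := (hasDerivAt_per hs a.1 y).sub (hasDerivAt_per hs b.1 y)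
    rwa [h, sub_self] at this
  have h2 := is_const_of_deriv_eq_zero (fun y => (h1 y).differentiableAt)
    (fun y => (h1 y).deriv) x 0
  have ha : per a.1 0 = 0 := a.2
  have hb : per b.1 0 = 0 := b.2
  simp only [ha, hb, sub_zero] at h2
  exact sub_eq_zero.mp h2

/-- The primitive `(Jg)(x) = ∫₀ˣ (g - ∫ g)` that vanishes at `0`. -/
def primitive (hs : 3 / 2 < s) : Sobolev (s - 1) →L[ℝ] vanishing s where
  toLinearMap := primitiveLinear s
  cont := by
    have := completeSpace (s := s) (by linarith)
    have := completeSpace (s := s - 1) (by linarith)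
    have := (isClosed_vanishing (s := s) (by linarith)).completeSpace_coe
    -- Differentiation is injective on functions vanishing at 0, so this one map separates points.
    refine (primitiveLinear s).continuous_of_separating (G := fun _ : Unit => Sobolev (s - 1))
      (fun _ f => derivCLM hs f.1)
      (fun _ => (derivCLM hs).continuous.comp continuous_subtype_val)
      (fun a b h => vanishing_eq_of_derivCLM_eq hs (h ())) fun _ => ?_
    have : (fun g : Sobolev (s - 1) => derivCLM hs (primitiveLinear s g).1) =
        fun g => g - mean g • one _ := funext (derivCLM_primitiveFun hs)
    rw [this]
    exact continuous_id.sub (continuous_mean.smul continuous_const)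

theorem per_primitive (hs : 3 / 2 < s) (g : Sobolev (s - 1)) (x : ℝ) :
    per (primitive hs g).1 x = (∫ y in (0 : ℝ)..x, per g y) - x * mean g :=
  per_primitiveFun g x

theorem derivCLM_primitive (hs : 3 / 2 < s) (g : Sobolev (s - 1)) :
    derivCLM hs (primitive hs g).1 = g - mean g • one _ := derivCLM_primitiveFun hs g

/-- The representative of zero mean, as a continuous linear map. -/
def reprCLM (s : ℝ) : (Sobolev s ⧸ constants s) →L[ℝ] Sobolev s where
  toLinearMap := repr s
  cont := by
    refine continuous_coinduced_dom.mpr ?_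
    exact continuous_id.sub (continuous_mean.smul continuous_const)

theorem repr_mkQ (f : Sobolev s) : repr s ((constants s).mkQ f) = f - mean f • one s := rfl

theorem mean_repr (q : Sobolev s ⧸ constants s) : mean (repr s q) = 0 := by
  obtain ⟨f, rfl⟩ := (constants s).mkQ_surjective q
  rw [repr_mkQ, ← meanCLM_apply, map_sub, map_smul]
  simp [mean_one]

/-- `per` is injective, so the choice in `ofFun` is forced and the default value 0 does not occur.
-/
theorem ofFun_eq {f : ℝ → ℝ} {g : Sobolev s} (h : per g = f) : ofFun s f = g := by
  have hex : ∃ g : Sobolev s, per g = f := ⟨g, h⟩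
  rw [ofFun, dif_pos hex]
  exact ext_per fun x => by rw [hex.choose_spec, h]

theorem ofFunVanishing_eq {f : ℝ → ℝ} {g : vanishing s} (h : per g.1 = f) :
    ofFunVanishing s f = g := by
  have hex : ∃ g : vanishing s, per g.1 = f := ⟨g, h⟩
  rw [ofFunVanishing, dif_pos hex]
  exact Subtype.ext <| ext_per fun x => by rw [hex.choose_spec, h]

end Sobolev

/-! ### The Christoffel map in the chart -/

namespace HunterSaxton

open Sobolev

variable {s : ℝ}

/-- The inner integral is f(y) - f(0), and the two resulting terms x f(0) cancel. -/
theorem invA_deriv {f : ℝ → ℝ} (hf : ContDiff ℝ 1 f) (x : ℝ) :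
    invA (deriv f) x = -(∫ y in (0 : ℝ)..x, f y) + x * ∫ y in (0 : ℝ)..1, f y := by
  have h1 : ∀ y, ∫ z in (0 : ℝ)..y, deriv f z = f y - f 0 := fun y =>
    intervalIntegral.integral_deriv_eq_sub (fun z _ => hf.differentiable one_ne_zero z)
      ((hf.continuous_deriv le_rfl).intervalIntegrable _ _)
  have h2 : ∀ y, ∫ z in (0 : ℝ)..y, (f z - f 0) = (∫ z in (0 : ℝ)..y, f z) - y * f 0 := fun y => by
    rw [intervalIntegral.integral_sub (hf.continuous.intervalIntegrable _ _)
      (continuous_const.intervalIntegrable _ _)]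
    simp
  simp only [invA, h1, h2]
  ring

theorem half_lt_sub_one (hs : 5 / 2 < s) : 1 / 2 < s - 1 := by linarith

theorem three_halves_lt (hs : 5 / 2 < s) : 3 / 2 < s := by linarith

theorem three_halves_lt_sub_one (hs : 5 / 2 < s) : 3 / 2 < s - 1 := by linarith

/-- Multiplication on `H^(s-1)(S¹)`. -/
def prod (hs : 5 / 2 < s) :
    Sobolev (s - 1) →L[ℝ] Sobolev (s - 1) →L[ℝ] Sobolev (s - 1) := mul (half_lt_sub_one hs)

@[simp] theorem per_prod (hs : 5 / 2 < s) (f g : Sobolev (s - 1)) (x : ℝ) :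
    per (prod hs f g) x = per f x * per g x := per_mul _ f g x

/-- The derivative of the first component of a tangent vector. -/
def fstDeriv (hs : 5 / 2 < s) : TangentK s →L[ℝ] Sobolev (s - 1) :=
  (derivCLM (three_halves_lt hs)).comp
    ((vanishing s).subtypeL.comp (ContinuousLinearMap.fst ℝ _ _))

theorem fstDeriv_apply (hs : 5 / 2 < s) (U : TangentK s) :
    fstDeriv hs U = derivCLM (three_halves_lt hs) U.1.1 := rfl

/-- The representative of zero mean of the second component of a tangent vector. -/
def sndRepr (s : ℝ) : TangentK s →L[ℝ] Sobolev (s - 1) :=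
  (reprCLM (s - 1)).comp (ContinuousLinearMap.snd ℝ _ _)

theorem sndRepr_apply (U : TangentK s) : sndRepr s U = repr (s - 1) U.2 := rfl

theorem snd_eq (U : TangentK s) : snd U = per (sndRepr s U) := rfl

theorem hasDerivAt_fst (hs : 5 / 2 < s) (U : TangentK s) (x : ℝ) :
    HasDerivAt (fst U) (per (fstDeriv hs U) x) x :=
  hasDerivAt_per (three_halves_lt hs) _ x

/-- The derivative `φₓ` as an element of `H^(s-1)(S¹)`. -/
def jacobian (hs : 5 / 2 < s) (p : TangentK s) : Sobolev (s - 1) := one _ + fstDeriv hs p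

/-- The reciprocal of `φₓ`, for `φ` near the identity. -/
def jacobianInv (hs : 5 / 2 < s) (p : TangentK s) : Sobolev (s - 1) :=
  Ring.inverse (prod hs (jacobian hs p)) (one _)

theorem hasDerivAt_flow (hs : 5 / 2 < s) (p : TangentK s) (x : ℝ) :
    HasDerivAt (flow p) (per (jacobian hs p) x) x := by
  rw [jacobian, per_add, per_one]
  exact (hasDerivAt_id x).add (hasDerivAt_fst hs p x)

theorem deriv_flow (hs : 5 / 2 < s) (p : TangentK s) : deriv (flow p) = per (jacobian hs p) :=
  funext fun x => (hasDerivAt_flow hs p x).deriv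

/-- If M is multiplication by φₓ, then `jacobianInv` is M⁻¹1, and M(M⁻¹1) = 1. The reciprocal is
thus obtained by inversion in the Banach algebra of operators on H^(s-1), where differentiability of
inversion is available. -/
theorem per_jacobian_mul_inv (hs : 5 / 2 < s) {p : TangentK s}
    (hp : IsUnit (prod hs (jacobian hs p))) (x : ℝ) :
    per (jacobian hs p) x * per (jacobianInv hs p) x = 1 := by
  have h := congrArg (fun L : Sobolev (s - 1) →L[ℝ] Sobolev (s - 1) => per (L (one _)) x)
    (Ring.mul_inverse_cancel _ hp)
  simpa [jacobianInv] using h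

/-- The projection `π` at `p`, with values in `H^(s-1)(S¹)`. -/
def projRepr (hs : 5 / 2 < s) (p U : TangentK s) : Sobolev (s - 1) :=
  sndRepr s U - mean (prod hs (sndRepr s U) (jacobian hs p)) • one _

/-- Four times the density of the metric. -/
def density (hs : 5 / 2 < s) (p U V : TangentK s) : Sobolev (s - 1) :=
  prod hs (prod hs (fstDeriv hs U) (fstDeriv hs V)) (jacobianInv hs p) -
    prod hs (prod hs (projRepr hs p U) (projRepr hs p V)) (jacobian hs p)

/-- The second component of the Christoffel map, up to a factor and constants. -/
def mixedTerm (hs : 5 / 2 < s) (p U V : TangentK s) : Sobolev (s - 1) :=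
  prod hs (prod hs (fstDeriv hs U) (jacobianInv hs p)) (projRepr hs p V) +
    prod hs (prod hs (fstDeriv hs V) (jacobianInv hs p)) (projRepr hs p U)

/-- The Christoffel map in the chart, without reference to `φ⁻¹`. -/
def chartChristoffel (hs : 5 / 2 < s) (p U V : TangentK s) : TangentK s :=
  ((1 / 2 : ℝ) • (primitive (three_halves_lt hs) (density hs p U V) -
      mean (density hs p U V) • p.1),
    (constants (s - 1)).mkQ (-(1 / 2 : ℝ) • mixedTerm hs p U V))

theorem flow_zero (p : TangentK s) : flow p 0 = 0 := by
  have : per p.1.1 0 = 0 := p.1.2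
  simp [flow, this]

theorem flow_one (p : TangentK s) : flow p 1 = 1 := by
  have h : per p.1.1 0 = 0 := p.1.2
  have h1 := per_add_one p.1.1 0
  rw [zero_add, h] at h1
  simp [flow, h1]

theorem abs_per_le (f : Sobolev s) (x : ℝ) : |per f x| ≤ ‖toCont f‖ :=
  (toCont f).norm_coe_le_norm x

/-- φ is strictly increasing with bounded displacement, hence bijective, and the inverse used in
`christoffel` is a genuine two-sided one. -/
theorem exists_flow_homeomorph (hs : 5 / 2 < s) {p : TangentK s} (hp : p ∈ K s) :
    ∃ e : ℝ ≃ₜ ℝ, ⇑e = flow p ∧ ⇑e.symm = Function.invFun (flow p) := by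
  have hmono : StrictMono (flow p) := strictMono_of_deriv_pos hp
  have hcont : Continuous (flow p) :=
    continuous_iff_continuousAt.mpr fun x => (hasDerivAt_flow hs p x).continuousAt
  have hsurj : Function.Surjective (flow p) := by
    refine hcont.surjective ?_ ?_
    · refine Filter.tendsto_atTop_mono (f := fun x => x + -‖toCont p.1.1‖) (fun x => ?_)
        (Filter.tendsto_atTop_add_const_right _ _ Filter.tendsto_id)
      have := abs_le.mp (abs_per_le p.1.1 x)
      simp only [flow]; linarith
    · refine Filter.tendsto_atBot_mono' _ (Filter.Eventually.of_forall fun x => ?_)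
        (Filter.tendsto_atBot_add_const_right _ ‖toCont p.1.1‖ Filter.tendsto_id)
      have := abs_le.mp (abs_per_le p.1.1 x)
      simp only [flow, id]; linarith
  refine ⟨(hmono.orderIsoOfSurjective _ hsurj).toHomeomorph, rfl, ?_⟩
  funext y
  refine hmono.injective ?_
  rw [Function.rightInverse_invFun hsurj y]
  exact (hmono.orderIsoOfSurjective _ hsurj).apply_symm_apply y

/-- Substituting y = φ(z) removes φ⁻¹ from every integral. The term with p.1 arises because A⁻¹∂ₓ
contributes φ(x) = x + w(x) times the mean, and the primitive accounts only for x. -/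
theorem christoffel_eq_chartChristoffel (hs : 5 / 2 < s) {p : TangentK s} (hp : p ∈ K s)
    (hu : IsUnit (prod hs (jacobian hs p))) (U V : TangentK s) :
    christoffel p U V = chartChristoffel hs p U V := by
  obtain ⟨e, he, hsymm⟩ := exists_flow_homeomorph hs hp
  have hji := per_jacobian_mul_inv hs hu
  have hpos : ∀ x, per (jacobian hs p) x ≠ 0 := fun x h => by simpa [h] using hji x
  have heφ : ∀ x, e.symm (flow p x) = x := fun x => by rw [← he]; exact e.symm_apply_apply x
  have hflow : ContDiff ℝ 1 (flow p) := by
    rw [contDiff_one_iff_deriv, deriv_flow hs]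
    exact ⟨fun x => (hasDerivAt_flow hs p x).differentiableAt, continuous_per _⟩
  have hψc : ContDiff ℝ 1 e.symm :=
    e.contDiff_symm_deriv hpos (fun x => by rw [he]; exact hasDerivAt_flow hs p x) (he ▸ hflow)
  have hψ : ∀ y, HasDerivAt e.symm (per (jacobianInv hs p) (e.symm y)) y := fun y => by
    have h := HasDerivAt.of_local_left_inverse (f := flow p) (g := e.symm) (a := y)
      e.symm.continuous.continuousAt (hasDerivAt_flow hs p (e.symm y)) (hpos _)
      (Filter.Eventually.of_forall fun z => by rw [← he]; exact e.apply_symm_apply z)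
    rwa [inv_eq_of_mul_eq_one_right (hji (e.symm y))] at h
  -- change of variables
  have hcv : ∀ (f : Sobolev (s - 1)) (x : ℝ), ∫ y in (0 : ℝ)..flow p x, per f (e.symm y) =
      ∫ y in (0 : ℝ)..x, per f y * per (jacobian hs p) y := fun f x => by
    have h := intervalIntegral.integral_comp_mul_deriv (a := 0) (b := x) (f := flow p)
      (g := per f ∘ e.symm) (fun z _ => hasDerivAt_flow hs p z)
      (continuous_per (jacobian hs p)).continuousOn ((continuous_per f).comp e.symm.continuous)
    rw [flow_zero] at h
    simp only [Function.comp_apply, heφ] at h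
    exact h.symm
  have hcv1 : ∀ f : Sobolev (s - 1), ∫ y in (0 : ℝ)..1, per f (e.symm y) =
      mean (prod hs f (jacobian hs p)) := fun f => by
    have h := hcv f 1
    rw [flow_one] at h
    rw [h, mean]
    simp only [per_prod]
  have hd : ∀ (W : TangentK s) (y : ℝ), deriv (fst W ∘ e.symm) y =
      per (prod hs (fstDeriv hs W) (jacobianInv hs p)) (e.symm y) := fun W y => by
    rw [((hasDerivAt_fst hs W (e.symm y)).comp y (hψ y)).deriv, per_prod]
  have hπ : ∀ (W : TangentK s) (y : ℝ), projId (snd W ∘ e.symm) y =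
      per (projRepr hs p W) (e.symm y) := fun W y => by
    simp only [projId, snd_eq, Function.comp_apply, hcv1, projRepr, per_sub, per_smul, per_one,
      mul_one]
  set Q : Sobolev (s - 1) := prod hs (prod hs (fstDeriv hs U) (jacobianInv hs p))
      (prod hs (fstDeriv hs V) (jacobianInv hs p)) -
    prod hs (projRepr hs p U) (projRepr hs p V) with hQ
  -- The Jacobian of the substitution cancels one of the two factors 1/φₓ in Q.
  have hQF : prod hs Q (jacobian hs p) = density hs p U V := ext_per fun x => by
    simp only [hQ, density, per_prod, per_sub]
    linear_combination (per (fstDeriv hs U) x * per (fstDeriv hs V) x * per (jacobianInv hs p) x) *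
      hji x
  have h1 : (ofFunVanishing s (christoffelId₁ (fst U ∘ e.symm) (snd U ∘ e.symm)
      (fst V ∘ e.symm) (snd V ∘ e.symm) ∘ flow p)) =
      (1 / 2 : ℝ) • (primitive (three_halves_lt hs) (density hs p U V) -
        mean (density hs p U V) • p.1) := by
    refine ofFunVanishing_eq (funext fun x => ?_)
    have hfun : (fun y => deriv (fst U ∘ e.symm) y * deriv (fst V ∘ e.symm) y -
        projId (snd U ∘ e.symm) y * projId (snd V ∘ e.symm) y) = per Q ∘ e.symm := by
      funext y
      simp only [hd, hπ, hQ, Function.comp_apply, per_sub, per_prod]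
    -- `invA_deriv` requires a C¹ function; Q is C¹ because s - 1 > 3/2.
    have hQc : ContDiff ℝ 1 (per Q ∘ e.symm) :=
      (contDiff_per (three_halves_lt_sub_one hs) Q).comp hψc
    simp only [Function.comp_apply, christoffelId₁]
    rw [hfun, invA_deriv hQc]
    simp only [Function.comp_apply]
    rw [hcv, hcv1, hQF, ← hQF]
    simp only [Submodule.coe_smul, Submodule.coe_sub, per_smul, per_sub, per_primitive, per_prod,
      flow]
    ring
  have h2 : (ofFun (s - 1) (christoffelId₂ (fst U ∘ e.symm) (snd U ∘ e.symm)
      (fst V ∘ e.symm) (snd V ∘ e.symm) ∘ flow p)) = -(1 / 2 : ℝ) • mixedTerm hs p U V := by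
    refine ofFun_eq (funext fun x => ?_)
    simp only [Function.comp_apply, christoffelId₂, hd, hπ, heφ, mixedTerm, per_smul, per_add,
      per_prod]
  simp only [christoffel, ← hsymm, h1, h2, chartChristoffel]

theorem jacobian_zero (hs : 5 / 2 < s) : jacobian hs 0 = one _ := by
  rw [jacobian, map_zero, add_zero]

theorem prod_one (hs : 5 / 2 < s) : prod hs (one _) = 1 := mul_one_left _

theorem continuous_jacobian (hs : 5 / 2 < s) : Continuous (jacobian hs) :=
  continuous_const.add (fstDeriv hs).continuous

theorem K_mem_nhds (hs : 5 / 2 < s) : K s ∈ nhds (0 : TangentK s) := by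
  have hc : Continuous fun p : TangentK s => ‖toCont (fstDeriv hs p)‖ :=
    ((continuous_toCont (half_lt_sub_one hs)).comp (fstDeriv hs).continuous).norm
  have h := hc.tendsto 0
  simp only [map_zero, norm_zero] at h
  filter_upwards [h.eventually (gt_mem_nhds one_pos)] with p hp x
  rw [deriv_flow hs, jacobian, per_add, per_one]
  have := abs_le.mp (abs_per_le (fstDeriv hs p) x)
  linarith

/-- At p = 0 the operator is the identity, and units form an open set in a Banach algebra. -/
theorem eventually_isUnit (hs : 5 / 2 < s) :
    ∀ᶠ p in nhds (0 : TangentK s), IsUnit (prod hs (jacobian hs p)) := by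
  have := completeSpace (half_lt_sub_one hs)
  have hc : Continuous fun p => prod hs (jacobian hs p) :=
    (prod hs).continuous.comp (continuous_jacobian hs)
  refine hc.continuousAt.eventually_mem (Units.isOpen.mem_nhds ?_)
  rw [jacobian_zero, prod_one]
  exact isUnit_one

theorem eventually_christoffel_eq (hs : 5 / 2 < s) :
    ∀ᶠ p in nhds (0 : TangentK s), ∀ U V, christoffel p U V = chartChristoffel hs p U V := by
  filter_upwards [K_mem_nhds hs, eventually_isUnit hs] with p hp hu
  exact christoffel_eq_chartChristoffel hs hp hu

end HunterSaxton

/-! ### Curvature of a connection given by a family of Christoffel maps -/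

/-- The derivative of `p ↦ G p (Y p) (X p)`, where `G 0` is bilinear and `D h U V` is the derivative
of `p ↦ G p U V` at `0` in the direction `h`. -/
theorem fderiv_bilinear_family {E : Type*} [NormedAddCommGroup E] [NormedSpace ℝ E]
    {G D : E → E → E → E}
    (hdiff : ∀ U V, DifferentiableAt ℝ (fun q : E × E × E => G q.1 q.2.1 q.2.2) (0, U, V))
    (hadd₁ : ∀ U U' V, G 0 (U + U') V = G 0 U V + G 0 U' V)
    (hadd₂ : ∀ U V V', G 0 U (V + V') = G 0 U V + G 0 U V')
    (hsmul₁ : ∀ (c : ℝ) U V, G 0 (c • U) V = c • G 0 U V)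
    (hsmul₂ : ∀ (c : ℝ) U V, G 0 U (c • V) = c • G 0 U V)
    (hcurve : ∀ h U V, HasDerivAt (fun t : ℝ => G (t • h) U V) (D h U V) 0)
    {Y X : E → E} (hY : DifferentiableAt ℝ Y 0) (hX : DifferentiableAt ℝ X 0) :
    DifferentiableAt ℝ (fun p => G p (Y p) (X p)) 0 ∧
      ∀ h, fderiv ℝ (fun p => G p (Y p) (X p)) 0 h =
        D h (Y 0) (X 0) + G 0 (fderiv ℝ Y 0 h) (X 0) + G 0 (Y 0) (fderiv ℝ X 0 h) := by
  set Φ : E × E × E → E := fun q => G q.1 q.2.1 q.2.2 with hΦ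
  set L := fderiv ℝ Φ (0, Y 0, X 0) with hL
  have hΦd : HasFDerivAt Φ L (0, Y 0, X 0) := (hdiff _ _).hasFDerivAt
  have hcomp : HasFDerivAt (fun p => G p (Y p) (X p))
      (L.comp ((ContinuousLinearMap.id ℝ E).prod ((fderiv ℝ Y 0).prod (fderiv ℝ X 0)))) 0 :=
    HasFDerivAt.comp (g := Φ) (f := fun p => (p, Y p, X p)) (0 : E) hΦd
      ((hasFDerivAt_id 0).prodMk (hY.hasFDerivAt.prodMk hX.hasFDerivAt))
  refine ⟨hcomp.differentiableAt, fun h => ?_⟩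
  have hline : ∀ v : E × E × E,
      HasDerivAt (fun t : ℝ => Φ ((0, Y 0, X 0) + t • v)) (L v) 0 := fun v => by
    have h1 : HasDerivAt (fun t : ℝ => (0, Y 0, X 0) + t • v) v 0 := by
      simpa using ((hasDerivAt_id (0 : ℝ)).smul_const v).const_add ((0, Y 0, X 0) : E × E × E)
    have h2 : HasFDerivAt Φ L ((0, Y 0, X 0) + (0 : ℝ) • v) := by simpa using hΦd
    exact h2.comp_hasDerivAt (0 : ℝ) h1
  -- The differential L is found on the three factors separately: on the first it is the given
  -- derivative, on the other two Φ is affine because G 0 is bilinear.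
  have e1 : L (h, 0, 0) = D h (Y 0) (X 0) := by
    refine (hline (h, 0, 0)).unique ?_
    simpa [hΦ] using hcurve h (Y 0) (X 0)
  have haffine : ∀ a b : E, HasDerivAt (fun t : ℝ => a + t • b) b 0 := fun a b => by
    simpa using ((hasDerivAt_id (0 : ℝ)).smul_const b).const_add a
  have e2 : ∀ k, L (0, k, 0) = G 0 k (X 0) := fun k => by
    refine (hline (0, k, 0)).unique ?_
    simpa [hΦ, hadd₁, hsmul₁] using haffine (G 0 (Y 0) (X 0)) (G 0 k (X 0))
  have e3 : ∀ k, L (0, 0, k) = G 0 (Y 0) k := fun k => by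
    refine (hline (0, 0, k)).unique ?_
    simpa [hΦ, hadd₂, hsmul₂] using haffine (G 0 (Y 0) (X 0)) (G 0 (Y 0) k)
  rw [hcomp.fderiv, ← e1, ← e2, ← e3, ← map_add, ← map_add]
  simp

/-- The curvature at `0` of the connection `∇_A B = DB · A - Γ(B, A)` on an open subset of a normed
space, where `Γ` agrees with the family `G` near `0`. -/
theorem curvature_bilinear_family {E : Type*} [NormedAddCommGroup E] [NormedSpace ℝ E]
    {Γ G D : E → E → E → E} (hΓ : ∀ᶠ p in nhds (0 : E), ∀ U V, Γ p U V = G p U V)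
    (hadd₁ : ∀ U U' V, G 0 (U + U') V = G 0 U V + G 0 U' V)
    (hadd₂ : ∀ U V V', G 0 U (V + V') = G 0 U V + G 0 U V')
    (hsmul₁ : ∀ (c : ℝ) U V, G 0 (c • U) V = c • G 0 U V)
    (hsmul₂ : ∀ (c : ℝ) U V, G 0 U (c • V) = c • G 0 U V)
    (hG : ∀ {Y X : E → E}, DifferentiableAt ℝ Y 0 → DifferentiableAt ℝ X 0 →
      DifferentiableAt ℝ (fun p => G p (Y p) (X p)) 0 ∧
        ∀ h, fderiv ℝ (fun p => G p (Y p) (X p)) 0 h =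
          D h (Y 0) (X 0) + G 0 (fderiv ℝ Y 0 h) (X 0) + G 0 (Y 0) (fderiv ℝ X 0 h))
    {X Y Z : E → E} (hX : DifferentiableAt ℝ X 0) (hY : DifferentiableAt ℝ Y 0)
    (hZ : ContDiffAt ℝ 2 Z 0) :
    let cov : (E → E) → (E → E) → E → E := fun A B p => fderiv ℝ B p (A p) - Γ p (B p) (A p)
    cov X (cov Y Z) 0 - cov Y (cov X Z) 0 - cov (VectorField.lieBracket ℝ X Y) Z 0 =
      D (Y 0) (Z 0) (X 0) - D (X 0) (Z 0) (Y 0) + G 0 (G 0 (Z 0) (Y 0)) (X 0) -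
        G 0 (G 0 (Z 0) (X 0)) (Y 0) := by
  intro cov
  have hZ1 : DifferentiableAt ℝ Z 0 := hZ.differentiableAt (by norm_num)
  have hZ2 : DifferentiableAt ℝ (fderiv ℝ Z) 0 :=
    (hZ.fderiv_right (m := 1) (by norm_num)).differentiableAt (by norm_num)
  have hcov : ∀ A B : E → E, cov A B 0 = fderiv ℝ B 0 (A 0) - G 0 (B 0) (A 0) := fun A B => by
    simp only [cov, hΓ.self_of_nhds]
  have hfderiv : ∀ {A : E → E}, DifferentiableAt ℝ A 0 → ∀ h, fderiv ℝ (cov A Z) 0 h =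
      fderiv ℝ (fderiv ℝ Z) 0 h (A 0) + fderiv ℝ Z 0 (fderiv ℝ A 0 h) -
        (D h (Z 0) (A 0) + G 0 (fderiv ℝ Z 0 h) (A 0) + G 0 (Z 0) (fderiv ℝ A 0 h)) := by
    intro A hA h
    have he : cov A Z =ᶠ[nhds 0] fun p => fderiv ℝ Z p (A p) - G p (Z p) (A p) := by
      filter_upwards [hΓ] with p hp
      simp only [cov, hp]
    obtain ⟨h1, h2⟩ := hG hZ1 hA
    have h3 := hZ2.hasFDerivAt.clm_apply hA.hasFDerivAt
    rw [he.fderiv_eq, fderiv_fun_sub h3.differentiableAt h1, h3.fderiv, sub_apply, h2]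
    simp [add_comm]
  -- The second derivatives of Z enter only through D²Z(X, Y) - D²Z(Y, X); the first derivatives of
  -- X and Y cancel against the bracket term.
  have hsymm := (hZ.isSymmSndFDerivAt (by simp)).eq (X 0) (Y 0)
  have hsub : ∀ U U' V, G 0 (U - U') V = G 0 U V - G 0 U' V := fun U U' V => by
    have h := hadd₁ U ((-1 : ℝ) • U') V
    rw [hsmul₁, neg_one_smul, neg_one_smul] at h
    rw [sub_eq_add_neg, h, sub_eq_add_neg]
  have hsub' : ∀ U V V', G 0 U (V - V') = G 0 U V - G 0 U V' := fun U V V' => by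
    have h := hadd₂ U V ((-1 : ℝ) • V')
    rw [hsmul₂, neg_one_smul, neg_one_smul] at h
    rw [sub_eq_add_neg, h, sub_eq_add_neg]
  rw [hcov, hcov, hcov, hcov, hcov, hfderiv hY, hfderiv hX, hsymm, VectorField.lieBracket, map_sub]
  simp only [hsub, hsub']
  abel

/-! ### Differentiating the Christoffel map at the identity -/

namespace HunterSaxton

open Sobolev

variable {s : ℝ}

theorem prod_comm (hs : 5 / 2 < s) (f g : Sobolev (s - 1)) : prod hs f g = prod hs g f :=
  ext_per fun x => by simp only [per_prod]; ring

@[simp] theorem prod_one_right (hs : 5 / 2 < s) (f : Sobolev (s - 1)) :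
    prod hs f (one _) = f := ext_per fun x => by simp

theorem differentiableAt_prod {E : Type*} [NormedAddCommGroup E] [NormedSpace ℝ E]
    (hs : 5 / 2 < s) {f g : E → Sobolev (s - 1)} {x : E} (hf : DifferentiableAt ℝ f x)
    (hg : DifferentiableAt ℝ g x) : DifferentiableAt ℝ (fun y => prod hs (f y) (g y)) x :=
  ((prod hs).differentiableAt.comp x hf).clm_apply hg

theorem hasDerivAt_prod (hs : 5 / 2 < s) {f g : ℝ → Sobolev (s - 1)}
    {f' g' : Sobolev (s - 1)} {t : ℝ} (hf : HasDerivAt f f' t) (hg : HasDerivAt g g' t) :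
    HasDerivAt (fun y => prod hs (f y) (g y)) (prod hs f' (g t) + prod hs (f t) g') t :=
  ((prod hs).hasFDerivAt.comp_hasDerivAt t hf).clm_apply hg

theorem jacobianInv_zero (hs : 5 / 2 < s) : jacobianInv hs 0 = one _ := by
  rw [jacobianInv, jacobian_zero, prod_one, Ring.inverse_one]
  rfl

theorem hasFDerivAt_jacobian (hs : 5 / 2 < s) (p : TangentK s) :
    HasFDerivAt (jacobian hs) (fstDeriv hs) p :=
  (fstDeriv hs).hasFDerivAt.const_add _

/-- Inversion of operators has differential -1 at the identity operator, and the multiplication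
operator is affine in p. -/
theorem hasFDerivAt_jacobianInv (hs : 5 / 2 < s) :
    HasFDerivAt (jacobianInv hs) (-fstDeriv hs) 0 := by
  have := completeSpace (half_lt_sub_one hs)
  have h1 : HasFDerivAt (fun p => prod hs (jacobian hs p)) ((prod hs).comp (fstDeriv hs)) 0 :=
    (prod hs).hasFDerivAt.comp 0 (hasFDerivAt_jacobian hs 0)
  have h2 := hasFDerivAt_ringInverse (𝕜 := ℝ) (1 : (Sobolev (s - 1) →L[ℝ] Sobolev (s - 1))ˣ)
  have e : ((1 : (Sobolev (s - 1) →L[ℝ] Sobolev (s - 1))ˣ) :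
      Sobolev (s - 1) →L[ℝ] Sobolev (s - 1)) = prod hs (jacobian hs 0) := by
    rw [jacobian_zero, prod_one]; rfl
  rw [e] at h2
  have h3 := ((ContinuousLinearMap.apply ℝ _ (one (s - 1))).hasFDerivAt).comp 0 (h2.comp 0 h1)
  refine h3.congr_fderiv ?_
  refine ContinuousLinearMap.ext fun h => ?_
  simp

theorem projRepr_zero (hs : 5 / 2 < s) (U : TangentK s) : projRepr hs 0 U = sndRepr s U := by
  rw [projRepr, jacobian_zero, prod_one_right, sndRepr_apply, mean_repr, zero_smul, sub_zero]

theorem density_zero (hs : 5 / 2 < s) (U V : TangentK s) :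
    density hs 0 U V = prod hs (fstDeriv hs U) (fstDeriv hs V) -
      prod hs (sndRepr s U) (sndRepr s V) := by
  simp only [density, projRepr_zero, jacobian_zero, jacobianInv_zero, prod_one_right]

theorem mixedTerm_zero (hs : 5 / 2 < s) (U V : TangentK s) :
    mixedTerm hs 0 U V = prod hs (fstDeriv hs U) (sndRepr s V) +
      prod hs (fstDeriv hs V) (sndRepr s U) := by
  simp only [mixedTerm, projRepr_zero, jacobianInv_zero, prod_one_right]

/-- The derivative of `projRepr` in the direction `h`, a constant. -/
def projDeriv (hs : 5 / 2 < s) (h U : TangentK s) : ℝ :=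
  -mean (prod hs (sndRepr s U) (fstDeriv hs h))

/-- The derivative of `density` at the identity in the direction `h`. -/
def densityDeriv (hs : 5 / 2 < s) (h U V : TangentK s) : Sobolev (s - 1) :=
  -prod hs (prod hs (fstDeriv hs U) (fstDeriv hs V)) (fstDeriv hs h)
    - projDeriv hs h U • sndRepr s V - projDeriv hs h V • sndRepr s U
    - prod hs (prod hs (sndRepr s U) (sndRepr s V)) (fstDeriv hs h)

/-- The derivative of `mixedTerm` at the identity in the direction `h`. -/
def mixedTermDeriv (hs : 5 / 2 < s) (h U V : TangentK s) : Sobolev (s - 1) :=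
  -prod hs (prod hs (fstDeriv hs U) (fstDeriv hs h)) (sndRepr s V)
    - prod hs (prod hs (fstDeriv hs V) (fstDeriv hs h)) (sndRepr s U)
    + projDeriv hs h V • fstDeriv hs U + projDeriv hs h U • fstDeriv hs V

/-- The derivative of the Christoffel map at the identity in the direction `h`. -/
def christoffelDeriv (hs : 5 / 2 < s) (h U V : TangentK s) : TangentK s :=
  ((1 / 2 : ℝ) • (primitive (three_halves_lt hs) (densityDeriv hs h U V) -
      mean (density hs 0 U V) • h.1),
    (constants (s - 1)).mkQ (-(1 / 2 : ℝ) • mixedTermDeriv hs h U V))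

theorem hasDerivAt_chartChristoffel (hs : 5 / 2 < s) (h U V : TangentK s) :
    HasDerivAt (fun t : ℝ => chartChristoffel hs (t • h) U V) (christoffelDeriv hs h U V) 0 := by
  have hp : HasDerivAt (fun t : ℝ => t • h) h 0 := by
    simpa using (hasDerivAt_id (0 : ℝ)).smul_const h
  have hp0 : (0 : ℝ) • h = 0 := zero_smul _ _
  have hj : HasDerivAt (fun t : ℝ => jacobian hs (t • h)) (fstDeriv hs h) 0 :=
    (hasFDerivAt_jacobian hs _).comp_hasDerivAt (0 : ℝ) hp
  have hi : HasDerivAt (fun t : ℝ => jacobianInv hs (t • h)) (-fstDeriv hs h) 0 :=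
    HasFDerivAt.comp_hasDerivAt (l := jacobianInv hs) (l' := -fstDeriv hs) (0 : ℝ)
      (by rw [hp0]; exact hasFDerivAt_jacobianInv hs) hp
  have hc : ∀ f : Sobolev (s - 1), HasDerivAt (fun _ : ℝ => f) 0 0 := fun f => hasDerivAt_const _ _
  have hπ : ∀ W, HasDerivAt (fun t : ℝ => projRepr hs (t • h) W) (projDeriv hs h W • one _) 0 :=
    fun W => by
      have h1 := (meanCLM (s - 1)).hasFDerivAt.comp_hasDerivAt (0 : ℝ)
        (hasDerivAt_prod hs (hc (sndRepr s W)) hj)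
      refine ((h1.smul_const (one (s - 1))).const_sub (sndRepr s W)).congr_deriv ?_
      simp [projDeriv]
  have hF : HasDerivAt (fun t : ℝ => density hs (t • h) U V) (densityDeriv hs h U V) 0 := by
    refine ((hasDerivAt_prod hs (hc _) hi).sub
      (hasDerivAt_prod hs (hasDerivAt_prod hs (hπ U) (hπ V)) hj)).congr_deriv (ext_per fun x => ?_)
    simp only [hp0, jacobian_zero, projRepr_zero, densityDeriv, per_sub, per_add, per_prod,
      per_smul, per_neg, per_one, per_zero]
    ring
  have hM : HasDerivAt (fun t : ℝ => mixedTerm hs (t • h) U V) (mixedTermDeriv hs h U V) 0 := by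
    refine ((hasDerivAt_prod hs (hasDerivAt_prod hs (hc _) hi) (hπ V)).add
      (hasDerivAt_prod hs (hasDerivAt_prod hs (hc _) hi) (hπ U))).congr_deriv (ext_per fun x => ?_)
    simp only [hp0, jacobianInv_zero, projRepr_zero, mixedTermDeriv, per_sub, per_add, per_prod,
      per_smul, per_neg, per_one, per_zero]
    ring
  refine HasDerivAt.prodMk ?_ ?_
  · have h1 := (primitive (three_halves_lt hs)).hasFDerivAt.comp_hasDerivAt (0 : ℝ) hF
    have h2 := (meanCLM (s - 1)).hasFDerivAt.comp_hasDerivAt (0 : ℝ) hF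
    have h3 := (ContinuousLinearMap.fst ℝ (vanishing s) _).hasFDerivAt.comp_hasDerivAt (0 : ℝ) hp
    -- The factor p.1 vanishes at t = 0, so the product rule keeps only the mean of the
    -- undifferentiated density times h.1.
    refine ((h1.sub (h2.smul h3)).const_smul (1 / 2 : ℝ)).congr_deriv ?_
    simp [hp0]
  · exact ((constants (s - 1)).mkQL).hasFDerivAt.comp_hasDerivAt (0 : ℝ)
      (hM.const_smul (-(1 / 2 : ℝ)))

/-- Derivatives along lines alone do not justify the chain rule along vector fields; joint
differentiability does. -/
theorem differentiableAt_chartChristoffel (hs : 5 / 2 < s) (U V : TangentK s) :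
    DifferentiableAt ℝ (fun q : TangentK s × TangentK s × TangentK s =>
      chartChristoffel hs q.1 q.2.1 q.2.2) (0, U, V) := by
  set x : TangentK s × TangentK s × TangentK s := (0, U, V)
  have hj : DifferentiableAt ℝ (fun q : TangentK s × TangentK s × TangentK s =>
      jacobian hs q.1) x :=
    DifferentiableAt.comp (g := jacobian hs) x (hasFDerivAt_jacobian hs _).differentiableAt
      differentiableAt_fst
  have hi : DifferentiableAt ℝ (fun q : TangentK s × TangentK s × TangentK s =>
      jacobianInv hs q.1) x :=
    DifferentiableAt.comp (g := jacobianInv hs) x (hasFDerivAt_jacobianInv hs).differentiableAt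
      differentiableAt_fst
  have hU : DifferentiableAt ℝ (fun q : TangentK s × TangentK s × TangentK s => q.2.1) x :=
    differentiableAt_snd.fst
  have hV : DifferentiableAt ℝ (fun q : TangentK s × TangentK s × TangentK s => q.2.2) x :=
    differentiableAt_snd.snd
  have hD : ∀ {f : TangentK s × TangentK s × TangentK s → TangentK s},
      DifferentiableAt ℝ f x → DifferentiableAt ℝ (fun q => fstDeriv hs (f q)) x :=
    fun hf => (fstDeriv hs).differentiableAt.comp x hf
  have hR : ∀ {f : TangentK s × TangentK s × TangentK s → TangentK s},
      DifferentiableAt ℝ f x → DifferentiableAt ℝ (fun q => sndRepr s (f q)) x :=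
    fun hf => (sndRepr s).differentiableAt.comp x hf
  have hm : ∀ {f : TangentK s × TangentK s × TangentK s → Sobolev (s - 1)},
      DifferentiableAt ℝ f x → DifferentiableAt ℝ (fun q => mean (f q)) x :=
    fun hf => (meanCLM (s - 1)).differentiableAt.comp x hf
  have hπ : ∀ {f : TangentK s × TangentK s × TangentK s → TangentK s},
      DifferentiableAt ℝ f x → DifferentiableAt ℝ (fun q => projRepr hs q.1 (f q)) x :=
    fun hf => (hR hf).sub ((hm (differentiableAt_prod hs (hR hf) hj)).smul_const _)
  have hF : DifferentiableAt ℝ (fun q : TangentK s × TangentK s × TangentK s =>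
      density hs q.1 q.2.1 q.2.2) x :=
    (differentiableAt_prod hs (differentiableAt_prod hs (hD hU) (hD hV)) hi).sub
      (differentiableAt_prod hs (differentiableAt_prod hs (hπ hU) (hπ hV)) hj)
  have hM : DifferentiableAt ℝ (fun q : TangentK s × TangentK s × TangentK s =>
      mixedTerm hs q.1 q.2.1 q.2.2) x :=
    (differentiableAt_prod hs (differentiableAt_prod hs (hD hU) hi) (hπ hV)).add
      (differentiableAt_prod hs (differentiableAt_prod hs (hD hV) hi) (hπ hU))
  refine DifferentiableAt.prodMk ?_ ?_
  · exact (((primitive (three_halves_lt hs)).differentiableAt.comp x hF).sub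
      ((hm hF).smul differentiableAt_fst.fst)).const_smul (1 / 2 : ℝ)
  · exact ((constants (s - 1)).mkQL).differentiableAt.comp x (hM.const_smul (-(1 / 2 : ℝ)))

/-- The Christoffel map at the identity. -/
theorem chartChristoffel_zero (hs : 5 / 2 < s) (U V : TangentK s) :
    chartChristoffel hs 0 U V =
      ((1 / 2 : ℝ) • primitive (three_halves_lt hs) (density hs 0 U V),
        (constants (s - 1)).mkQ (-(1 / 2 : ℝ) • mixedTerm hs 0 U V)) := by
  simp [chartChristoffel]

theorem density_zero_comm (hs : 5 / 2 < s) (U V : TangentK s) :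
    density hs 0 U V = density hs 0 V U := by
  rw [density_zero, density_zero, prod_comm hs (fstDeriv hs U), prod_comm hs (sndRepr s U)]

theorem mixedTerm_zero_comm (hs : 5 / 2 < s) (U V : TangentK s) :
    mixedTerm hs 0 U V = mixedTerm hs 0 V U := by
  rw [mixedTerm_zero, mixedTerm_zero, add_comm]

theorem chartChristoffel_zero_comm (hs : 5 / 2 < s) (U V : TangentK s) :
    chartChristoffel hs 0 U V = chartChristoffel hs 0 V U := by
  rw [chartChristoffel_zero, chartChristoffel_zero, density_zero_comm, mixedTerm_zero_comm]

theorem chartChristoffel_zero_add (hs : 5 / 2 < s) (U U' V : TangentK s) :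
    chartChristoffel hs 0 (U + U') V =
      chartChristoffel hs 0 U V + chartChristoffel hs 0 U' V := by
  have h1 : density hs 0 (U + U') V = density hs 0 U V + density hs 0 U' V := by
    simp only [density_zero, map_add, add_apply]; abel
  have h2 : mixedTerm hs 0 (U + U') V = mixedTerm hs 0 U V + mixedTerm hs 0 U' V := by
    simp only [mixedTerm_zero, map_add, add_apply]; abel
  simp only [chartChristoffel_zero, h1, h2, map_add, smul_add, Prod.mk_add_mk]

theorem chartChristoffel_zero_smul (hs : 5 / 2 < s) (c : ℝ) (U V : TangentK s) :
    chartChristoffel hs 0 (c • U) V = c • chartChristoffel hs 0 U V := by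
  have h1 : density hs 0 (c • U) V = c • density hs 0 U V := by
    simp only [density_zero, map_smul, smul_apply, smul_sub]
  have h2 : mixedTerm hs 0 (c • U) V = c • mixedTerm hs 0 U V := by
    simp only [mixedTerm_zero, map_smul, smul_apply, smul_add]
  simp only [chartChristoffel_zero, h1, h2, map_smul, Prod.smul_mk, smul_comm c]

theorem chartChristoffel_zero_add_right (hs : 5 / 2 < s) (U V V' : TangentK s) :
    chartChristoffel hs 0 U (V + V') =
      chartChristoffel hs 0 U V + chartChristoffel hs 0 U V' := by
  rw [chartChristoffel_zero_comm, chartChristoffel_zero_add, chartChristoffel_zero_comm hs V,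
    chartChristoffel_zero_comm hs V']

theorem chartChristoffel_zero_smul_right (hs : 5 / 2 < s) (c : ℝ) (U V : TangentK s) :
    chartChristoffel hs 0 U (c • V) = c • chartChristoffel hs 0 U V := by
  rw [chartChristoffel_zero_comm, chartChristoffel_zero_smul, chartChristoffel_zero_comm]

theorem fderiv_christoffel (hs : 5 / 2 < s) {Y X : TangentK s → TangentK s}
    (hY : DifferentiableAt ℝ Y 0) (hX : DifferentiableAt ℝ X 0) :
    DifferentiableAt ℝ (fun p => chartChristoffel hs p (Y p) (X p)) 0 ∧
      ∀ h, fderiv ℝ (fun p => chartChristoffel hs p (Y p) (X p)) 0 h =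
        christoffelDeriv hs h (Y 0) (X 0) + chartChristoffel hs 0 (fderiv ℝ Y 0 h) (X 0) +
          chartChristoffel hs 0 (Y 0) (fderiv ℝ X 0 h) :=
  fderiv_bilinear_family (differentiableAt_chartChristoffel hs) (chartChristoffel_zero_add hs)
    (chartChristoffel_zero_add_right hs) (chartChristoffel_zero_smul hs)
    (chartChristoffel_zero_smul_right hs) (hasDerivAt_chartChristoffel hs) hY hX

/-- The curvature at the identity in terms of the Christoffel map and its derivative. -/
theorem curvature_zero (hs : 5 / 2 < s) {X Y Z : TangentK s → TangentK s}
    (hX : DifferentiableAt ℝ X 0) (hY : DifferentiableAt ℝ Y 0) (hZ : ContDiffAt ℝ 2 Z 0) :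
    curvature X Y Z 0 =
      christoffelDeriv hs (Y 0) (Z 0) (X 0) - christoffelDeriv hs (X 0) (Z 0) (Y 0) +
        chartChristoffel hs 0 (chartChristoffel hs 0 (Z 0) (Y 0)) (X 0) -
        chartChristoffel hs 0 (chartChristoffel hs 0 (Z 0) (X 0)) (Y 0) :=
  curvature_bilinear_family (eventually_christoffel_eq hs) (chartChristoffel_zero_add hs)
    (chartChristoffel_zero_add_right hs) (chartChristoffel_zero_smul hs)
    (chartChristoffel_zero_smul_right hs) (fun hY hX => fderiv_christoffel hs hY hX) hX hY hZ

/-- The right-hand side of `curvature_zero` contains only the values of the fields at the identity,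
so constant fields give the same result. Smoothness on K^s passes to the point because K^s is a
neighbourhood of it. -/
theorem curvature_eq_curvatureTensor (hs : 5 / 2 < s) {X Y Z : TangentK s → TangentK s}
    (hX : ContDiffOn ℝ ∞ X (K s)) (hY : ContDiffOn ℝ ∞ Y (K s)) (hZ : ContDiffOn ℝ ∞ Z (K s)) :
    curvature X Y Z (idK s) = curvatureTensor (idK s) (X (idK s)) (Y (idK s)) (Z (idK s)) := by
  have hK := K_mem_nhds hs
  rw [curvatureTensor, idK,
    curvature_zero hs ((hX.contDiffAt hK).differentiableAt (by simp))
      ((hY.contDiffAt hK).differentiableAt (by simp))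
      ((hZ.contDiffAt hK).of_le (WithTop.coe_le_coe.mpr le_top)),
    curvature_zero hs (differentiableAt_const _) (differentiableAt_const _) contDiffAt_const]

end HunterSaxton

/-! ### Trigonometric functions in H^s -/

/-- Solutions of `f'' = -4π² f` belong to all Sobolev spaces. -/
theorem exists_sobolev_of_harmonic (s : ℝ) {f g : ℝ → ℝ} (hfp : Function.Periodic f 1)
    (hgp : Function.Periodic g 1) (hf : ∀ x, HasDerivAt f (g x) x)
    (hg : ∀ x, HasDerivAt g (-(2 * Real.pi) ^ 2 * f x) x) :
    ∃ F : Sobolev s, Sobolev.per F = f := by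
  obtain ⟨F, hF⟩ := exists_circle_eq
    (continuous_iff_continuousAt.mpr fun x => (hf x).continuousAt) hfp
  obtain ⟨G, hG⟩ := exists_circle_eq
    (continuous_iff_continuousAt.mpr fun x => (hg x).continuousAt) hgp
  -- Differentiating twice gives (k² - 1) f̂(k) = 0 for k ≠ 0. Frequency 0 is left open, which is
  -- harmless since a finite exceptional set suffices.
  have h0 : ∀ k : ℤ, k ∉ ({0, 1, -1} : Finset ℤ) → realFourier F k = 0 := fun k hk => by
    simp only [Finset.mem_insert, Finset.mem_singleton, not_or] at hk
    obtain ⟨hk0, hk1, hk2⟩ := hk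
    have h1 := realFourier_deriv (f := F) (g := G) (fun x => by
      rw [hG, funext hF]; exact hf x) hk0
    have h2 := realFourier_deriv (f := G) (g := (-(2 * Real.pi) ^ 2) • F) (fun x => by
      rw [ContinuousMap.smul_apply, hF, funext hG]; exact hg x) hk0
    rw [realFourier_smul, h1, Complex.real_smul] at h2
    push_cast at h2
    have hpi : (Real.pi : ℂ) ≠ 0 := by exact_mod_cast Real.pi_ne_zero
    have h3 : (4 * (Real.pi : ℂ) ^ 2 * (((k : ℂ) - 1) * ((k : ℂ) + 1))) * realFourier F k = 0 := by
      linear_combination h2 + 4 * (Real.pi : ℂ) ^ 2 * (k : ℂ) ^ 2 * realFourier F k * Complex.I_sq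
    have hk1' : (k : ℂ) - 1 ≠ 0 := sub_ne_zero.mpr (by exact_mod_cast hk1)
    have hk2' : (k : ℂ) + 1 ≠ 0 := by
      rw [← sub_neg_eq_add]
      exact sub_ne_zero.mpr (by exact_mod_cast hk2)
    exact (mul_eq_zero.mp h3).resolve_left (by simp [hpi, hk1', hk2'])
  have hmem : F ∈ sobolevSubmodule s := by
    rw [mem_sobolevSubmodule_iff]
    exact summable_of_ne_finset_zero (s := {0, 1, -1}) fun k hk => by simp [h0 k hk]
  obtain ⟨f', hf'⟩ := Sobolev.exists_toCont_eq hmem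
  exact ⟨f', funext fun x => by rw [← Sobolev.toCont_coe, hf', hF]⟩

/-! ### The curvature formula at the identity -/

namespace HunterSaxton

open Sobolev

variable {s : ℝ}

theorem mean_sub (f g : Sobolev s) : mean (f - g) = mean f - mean g := map_sub (meanCLM s) f g

theorem mean_zero : mean (0 : Sobolev s) = 0 := map_zero (meanCLM s)

theorem mean_fstDeriv (hs : 5 / 2 < s) (U : TangentK s) : mean (fstDeriv hs U) = 0 :=
  mean_derivCLM (three_halves_lt hs) _

theorem mean_sndRepr (U : TangentK s) : mean (sndRepr s U) = 0 := mean_repr _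

theorem metric_zero (hs : 5 / 2 < s) (U V : TangentK s) :
    metric 0 U V = (1 / 4) * mean (density hs 0 U V) := by
  have hd : ∀ x, deriv (flow (0 : TangentK s)) x = 1 := fun x => by
    rw [deriv_flow hs, jacobian_zero, per_one]
  have hπ : ∀ (W : TangentK s) x, proj 0 W x = per (sndRepr s W) x := fun W x => by
    have h : ∫ y in (0 : ℝ)..1, per (sndRepr s W) y = 0 := mean_sndRepr W
    simp only [proj, hd, mul_one, snd_eq, h, sub_zero]
  have hf : ∀ (W : TangentK s) x, deriv (fst W) x = per (fstDeriv hs W) x := fun W x =>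
    (hasDerivAt_fst hs W x).deriv
  simp only [metric, hd, hπ, hf, div_one, mul_one, mean, density_zero, per_sub, per_prod]

theorem metric_zero_eq (hs : 5 / 2 < s) (U V : TangentK s) :
    metric 0 U V = (1 / 4) * (mean (prod hs (fstDeriv hs U) (fstDeriv hs V)) -
      mean (prod hs (sndRepr s U) (sndRepr s V))) := by
  rw [metric_zero hs, density_zero, mean_sub]

/-- Integration by parts moves the derivative to the first components, which vanish at both ends of
the period. After this, only u₁ₓ and u₂ occur in metric and form alike. -/
theorem symplectic_eq (hs : 5 / 2 < s) (U V : TangentK s) :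
    symplectic U V = (1 / 4) * (mean (prod hs (sndRepr s V) (fstDeriv hs U)) -
      mean (prod hs (sndRepr s U) (fstDeriv hs V))) := by
  have hc : ∀ W : TangentK s, Continuous (deriv (snd W)) := fun W => by
    rw [snd_eq, deriv_per (three_halves_lt_sub_one hs)]
    exact continuous_per _
  have hcf : ∀ W : TangentK s, Continuous (fst W) := fun W => continuous_per _
  have hparts : ∀ W W' : TangentK s, ∫ x in (0 : ℝ)..1, deriv (snd W) x * fst W' x =
      -mean (prod hs (sndRepr s W) (fstDeriv hs W')) := fun W W' => by
    have h := intervalIntegral.integral_mul_deriv_eq_deriv_mul (a := 0) (b := 1)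
      (u := snd W) (u' := deriv (snd W)) (v := fst W') (v' := per (fstDeriv hs W'))
      (fun x _ => by
        rw [snd_eq, deriv_per (three_halves_lt_sub_one hs)]
        exact hasDerivAt_per _ _ _)
      (fun x _ => hasDerivAt_fst hs W' x) ((hc W).intervalIntegrable _ _)
      (intervalIntegrable_per _)
    have h0 : fst W' 0 = 0 := W'.1.2
    have h1 : fst W' 1 = 0 := by
      have := per_add_one W'.1.1 0
      rw [zero_add] at this
      exact this.trans h0
    rw [h0, h1] at h
    simp only [mean, per_prod, ← snd_eq]
    linarith
  have h := intervalIntegral.integral_sub (((hc U).mul (hcf V)).intervalIntegrable 0 1)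
    (((hc V).mul (hcf U)).intervalIntegrable 0 1) (μ := MeasureTheory.volume)
  simp only [Pi.mul_apply, hparts] at h
  rw [symplectic, h]
  ring

/-- Differentiation undoes the primitive up to a mean. This and the next three formulas reduce the
curvature to pointwise algebra. -/
theorem per_fstDeriv_chartChristoffel (hs : 5 / 2 < s) (U V : TangentK s) (x : ℝ) :
    per (fstDeriv hs (chartChristoffel hs 0 U V)) x =
      (1 / 2) * (per (fstDeriv hs U) x * per (fstDeriv hs V) x -
        per (sndRepr s U) x * per (sndRepr s V) x - mean (density hs 0 U V)) := by
  have h : fstDeriv hs (chartChristoffel hs 0 U V) =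
      (1 / 2 : ℝ) • (density hs 0 U V - mean (density hs 0 U V) • one _) := by
    rw [chartChristoffel_zero, fstDeriv_apply, Submodule.coe_smul, map_smul, derivCLM_primitive]
  rw [h, per_smul, per_sub, per_smul, per_one, mul_one]
  simp only [density_zero, per_sub, per_prod]

theorem per_sndRepr_chartChristoffel (hs : 5 / 2 < s) (U V : TangentK s) (x : ℝ) :
    per (sndRepr s (chartChristoffel hs 0 U V)) x =
      -(1 / 2) * (per (fstDeriv hs U) x * per (sndRepr s V) x +
        per (fstDeriv hs V) x * per (sndRepr s U) x - mean (mixedTerm hs 0 U V)) := by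
  have h : sndRepr s (chartChristoffel hs 0 U V) =
      -(1 / 2 : ℝ) • (mixedTerm hs 0 U V - mean (mixedTerm hs 0 U V) • one _) := by
    rw [chartChristoffel_zero, sndRepr_apply, map_smul, map_smul, repr_mkQ]
  rw [h, per_smul, per_sub, per_smul, per_one, mul_one]
  simp only [mixedTerm_zero, per_add, per_prod]

theorem per_fstDeriv_christoffelDeriv (hs : 5 / 2 < s) (h U V : TangentK s) (x : ℝ) :
    per (fstDeriv hs (christoffelDeriv hs h U V)) x =
      (1 / 2) * (-(per (fstDeriv hs U) x * per (fstDeriv hs V) x * per (fstDeriv hs h) x)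
        - projDeriv hs h U * per (sndRepr s V) x - projDeriv hs h V * per (sndRepr s U) x
        - per (sndRepr s U) x * per (sndRepr s V) x * per (fstDeriv hs h) x
        - mean (densityDeriv hs h U V) - mean (density hs 0 U V) * per (fstDeriv hs h) x) := by
  have h : fstDeriv hs (christoffelDeriv hs h U V) =
      (1 / 2 : ℝ) • (densityDeriv hs h U V - mean (densityDeriv hs h U V) • one _ -
        mean (density hs 0 U V) • fstDeriv hs h) := by
    rw [christoffelDeriv, fstDeriv_apply, Submodule.coe_smul, map_smul, Submodule.coe_sub, map_sub,
      derivCLM_primitive, Submodule.coe_smul, map_smul, fstDeriv_apply]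
  rw [h, per_smul, per_sub, per_sub, per_smul, per_smul, per_one, mul_one]
  simp only [densityDeriv, per_sub, per_prod, per_smul, per_neg]

theorem per_sndRepr_christoffelDeriv (hs : 5 / 2 < s) (h U V : TangentK s) (x : ℝ) :
    per (sndRepr s (christoffelDeriv hs h U V)) x =
      -(1 / 2) * (-(per (fstDeriv hs U) x * per (fstDeriv hs h) x * per (sndRepr s V) x)
        - per (fstDeriv hs V) x * per (fstDeriv hs h) x * per (sndRepr s U) x
        + projDeriv hs h V * per (fstDeriv hs U) x + projDeriv hs h U * per (fstDeriv hs V) x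
        - mean (mixedTermDeriv hs h U V)) := by
  have h : sndRepr s (christoffelDeriv hs h U V) =
      -(1 / 2 : ℝ) • (mixedTermDeriv hs h U V - mean (mixedTermDeriv hs h U V) • one _) := by
    rw [christoffelDeriv, sndRepr_apply, map_smul, map_smul, repr_mkQ]
  rw [h, per_smul, per_sub, per_smul, per_one, mul_one]
  simp only [mixedTermDeriv, per_sub, per_add, per_prod, per_smul, per_neg]

theorem curvatureTensor_zero (hs : 5 / 2 < s) (u v w : TangentK s) :
    curvatureTensor 0 u v w =
      christoffelDeriv hs v w u - christoffelDeriv hs u w v +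
        chartChristoffel hs 0 (chartChristoffel hs 0 w v) u -
        chartChristoffel hs 0 (chartChristoffel hs 0 w u) v :=
  curvature_zero hs (differentiableAt_const _) (differentiableAt_const _) contDiffAt_const

theorem metric_curvatureTensor (hs : 5 / 2 < s) (u v : TangentK s) :
    metric 0 (curvatureTensor 0 u v v) u =
      metric 0 u u * metric 0 v v - metric 0 u v ^ 2 - 3 * symplectic u v ^ 2 := by
  have hu := mean_fstDeriv hs u
  have hu' := mean_sndRepr u
  rw [curvatureTensor_zero hs, symplectic_eq hs, metric_zero_eq hs u u, metric_zero_eq hs v v,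
    metric_zero_eq hs u v, metric_zero_eq hs, ← mean_sub]
  set R := christoffelDeriv hs v v u - christoffelDeriv hs u v v +
    chartChristoffel hs 0 (chartChristoffel hs 0 v v) u -
    chartChristoffel hs 0 (chartChristoffel hs 0 v u) v with hR
  -- The identity is pointwise: all products of four pointwise values cancel, and the surviving
  -- coefficients are means.
  have key : prod hs (fstDeriv hs R) (fstDeriv hs u) - prod hs (sndRepr s R) (sndRepr s u) =
      (-mean (prod hs (sndRepr s v) (fstDeriv hs u))
          + (1 / 2) * mean (prod hs (sndRepr s u) (fstDeriv hs v))
          + (1 / 4) * (mean (prod hs (sndRepr s v) (fstDeriv hs u))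
            + mean (prod hs (sndRepr s u) (fstDeriv hs v)))) •
        (prod hs (sndRepr s v) (fstDeriv hs u) - prod hs (sndRepr s u) (fstDeriv hs v)) +
      ((1 / 4) * mean (density hs 0 v v)) •
        (prod hs (fstDeriv hs u) (fstDeriv hs u) - prod hs (sndRepr s u) (sndRepr s u)) -
      ((1 / 4) * mean (density hs 0 u v)) •
        (prod hs (fstDeriv hs u) (fstDeriv hs v) - prod hs (sndRepr s u) (sndRepr s v)) -
      ((1 / 2) * (mean (densityDeriv hs v v u) - mean (densityDeriv hs u v v)
        + mean (density hs 0 (chartChristoffel hs 0 v v) u)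
        - mean (density hs 0 (chartChristoffel hs 0 v u) v))) • fstDeriv hs u -
      ((1 / 2) * (mean (mixedTermDeriv hs v v u) - mean (mixedTermDeriv hs u v v)
        + mean (mixedTerm hs 0 (chartChristoffel hs 0 v v) u)
        - mean (mixedTerm hs 0 (chartChristoffel hs 0 v u) v))) • sndRepr s u := by
    have hvv : mean (mixedTerm hs 0 v v) = 2 * mean (prod hs (sndRepr s v) (fstDeriv hs v)) := by
      rw [mixedTerm_zero, mean_add, prod_comm hs (fstDeriv hs v)]; ring
    have hvu : mean (mixedTerm hs 0 v u) = mean (prod hs (sndRepr s v) (fstDeriv hs u)) +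
        mean (prod hs (sndRepr s u) (fstDeriv hs v)) := by
      rw [mixedTerm_zero, mean_add, prod_comm hs (fstDeriv hs v), prod_comm hs (fstDeriv hs u),
        add_comm]
    have hdvu : mean (density hs 0 v u) = mean (density hs 0 u v) := by rw [density_zero_comm]
    refine ext_per fun x => ?_
    have hR₁ : per (fstDeriv hs R) x = per (fstDeriv hs (christoffelDeriv hs v v u)) x -
        per (fstDeriv hs (christoffelDeriv hs u v v)) x +
        per (fstDeriv hs (chartChristoffel hs 0 (chartChristoffel hs 0 v v) u)) x -
        per (fstDeriv hs (chartChristoffel hs 0 (chartChristoffel hs 0 v u) v)) x := by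
      rw [hR, map_sub, map_add, map_sub, per_sub, per_add, per_sub]
    have hR₂ : per (sndRepr s R) x = per (sndRepr s (christoffelDeriv hs v v u)) x -
        per (sndRepr s (christoffelDeriv hs u v v)) x +
        per (sndRepr s (chartChristoffel hs 0 (chartChristoffel hs 0 v v) u)) x -
        per (sndRepr s (chartChristoffel hs 0 (chartChristoffel hs 0 v u) v)) x := by
      rw [hR, map_sub, map_add, map_sub, per_sub, per_add, per_sub]
    simp only [per_fstDeriv_chartChristoffel, per_sndRepr_chartChristoffel,
      per_fstDeriv_christoffelDeriv, per_sndRepr_christoffelDeriv, hvv, hvu, hdvu] at hR₁ hR₂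
    simp only [per_sub, per_add, per_smul, per_prod, hR₁, hR₂, projDeriv]
    ring
  rw [key]
  -- Integration kills the multiples of u₁ₓ and u₂. With a = ∫v₂u₁ₓ and b = ∫u₂v₁ₓ, the first
  -- coefficient -a + b/2 + (a + b)/4 equals -¾(a - b), which is the source of -3ω².
  simp only [mean_add, mean_sub, mean_smul, hu, hu', density_zero]
  ring

/-! ### Planes of large curvature -/

/-- The functions are √2 cos(2πx) and √2 sin(2πx); their means and those of their products come from
explicit antiderivatives. -/
theorem exists_orthonormal (s : ℝ) (hs : 1 / 2 < s) : ∃ c d : Sobolev s, mean c = 0 ∧ mean d = 0 ∧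
    mean (mul hs c c) = 1 ∧ mean (mul hs d d) = 1 ∧ mean (mul hs c d) = 0 := by
  have hcos : ∀ x : ℝ, HasDerivAt (fun x => Real.cos (2 * Real.pi * x))
      (-(2 * Real.pi) * Real.sin (2 * Real.pi * x)) x := fun x => by
    have := (Real.hasDerivAt_cos (2 * Real.pi * x)).comp x
      ((hasDerivAt_id x).const_mul (2 * Real.pi))
    refine this.congr_deriv ?_
    ring
  have hsin : ∀ x : ℝ, HasDerivAt (fun x => Real.sin (2 * Real.pi * x))
      (2 * Real.pi * Real.cos (2 * Real.pi * x)) x := fun x => by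
    have := (Real.hasDerivAt_sin (2 * Real.pi * x)).comp x
      ((hasDerivAt_id x).const_mul (2 * Real.pi))
    refine this.congr_deriv ?_
    ring
  have pcos : Function.Periodic (fun x => Real.cos (2 * Real.pi * x)) 1 := fun x => by
    simp only [mul_add, mul_one, Real.cos_add_two_pi]
  have psin : Function.Periodic (fun x => Real.sin (2 * Real.pi * x)) 1 := fun x => by
    simp only [mul_add, mul_one, Real.sin_add_two_pi]
  obtain ⟨c, hc⟩ := exists_sobolev_of_harmonic s pcos (fun x => by simp only [psin x]) hcos
    fun x => ((hsin x).const_mul _).congr_deriv (by ring)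
  obtain ⟨d, hd⟩ := exists_sobolev_of_harmonic s psin (fun x => by simp only [pcos x]) hsin
    fun x => ((hcos x).const_mul _).congr_deriv (by ring)
  have hpi : (2 * Real.pi) ≠ 0 := by positivity
  have hftc : ∀ (f : Sobolev s) (F : ℝ → ℝ), (∀ x, HasDerivAt F (per f x) x) →
      mean f = F 1 - F 0 := fun f F hF =>
    intervalIntegral.integral_eq_sub_of_hasDerivAt (fun x _ => hF x) (intervalIntegrable_per f)
  have mc : mean c = 0 := by
    rw [hftc c (fun x => (2 * Real.pi)⁻¹ * Real.sin (2 * Real.pi * x)) fun x => by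
      refine ((hsin x).const_mul _).congr_deriv ?_
      rw [hc]; field_simp]
    simp
  have md : mean d = 0 := by
    rw [hftc d (fun x => -(2 * Real.pi)⁻¹ * Real.cos (2 * Real.pi * x)) fun x => by
      refine ((hcos x).const_mul _).congr_deriv ?_
      rw [hd]; field_simp]
    simp
  have mcc : mean (mul hs c c) = 1 / 2 := by
    rw [hftc _ (fun x => (1 / 2) * x + (4 * Real.pi)⁻¹ * (Real.sin (2 * Real.pi * x) *
      Real.cos (2 * Real.pi * x))) fun x => by
      refine (((hasDerivAt_id x).const_mul _).add
        (((hsin x).mul (hcos x)).const_mul _)).congr_deriv ?_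
      rw [per_mul, hc]
      have := Real.sin_sq_add_cos_sq (2 * Real.pi * x)
      field_simp
      linear_combination (-4) * this]
    simp
  have mdd : mean (mul hs d d) = 1 / 2 := by
    rw [hftc _ (fun x => (1 / 2) * x - (4 * Real.pi)⁻¹ * (Real.sin (2 * Real.pi * x) *
      Real.cos (2 * Real.pi * x))) fun x => by
      refine (((hasDerivAt_id x).const_mul _).sub
        (((hsin x).mul (hcos x)).const_mul _)).congr_deriv ?_
      rw [per_mul, hd]
      have := Real.sin_sq_add_cos_sq (2 * Real.pi * x)
      field_simp
      linear_combination (-4) * this]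
    simp
  have mcd : mean (mul hs c d) = 0 := by
    rw [hftc _ (fun x => (4 * Real.pi)⁻¹ * Real.sin (2 * Real.pi * x) ^ 2) fun x => by
      refine (((hsin x).pow 2).const_mul _).congr_deriv ?_
      rw [per_mul, hc, hd]
      field_simp
      ring]
    simp
  have h2 : √(2 : ℝ) * √2 = 2 := Real.mul_self_sqrt (by norm_num)
  refine ⟨√2 • c, √2 • d, ?_, ?_, ?_, ?_, ?_⟩ <;>
    simp only [map_smul, smul_apply, mean_smul, mc, md, mcc, mdd, mcd, mul_zero, ← mul_assoc, h2] <;>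
    norm_num

/-- Nondegenerate planes of curvature `1 - 3 / (t - 1)`. -/
theorem exists_sec_eq (hs : 5 / 2 < s) {t : ℝ} (ht : 0 ≤ t) (ht1 : t ≠ 1) :
    ∃ u v : TangentK s, areaForm (idK s) u v ≠ 0 ∧ sec (idK s) u v = 1 - 3 / (t - 1) := by
  obtain ⟨c, d, mc, md, mcc, mdd, mcd⟩ := exists_orthonormal (s - 1) (half_lt_sub_one hs)
  let J := primitive (three_halves_lt hs)
  have hJ : ∀ f : Sobolev (s - 1), mean f = 0 → ∀ q, fstDeriv hs (J f, q) = f := fun f hf q => by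
    rw [fstDeriv_apply, derivCLM_primitive, hf, zero_smul, sub_zero]
  have hu₂ : sndRepr s (J c, 0) = 0 := by rw [sndRepr_apply, map_zero]
  have hv₂ : sndRepr s (J (√t • d), (constants (s - 1)).mkQ c) = c := by
    rw [sndRepr_apply, repr_mkQ, mc, zero_smul, sub_zero]
  have hv₁ := hJ (√t • d) (by rw [mean_smul, md, mul_zero]) ((constants (s - 1)).mkQ c)
  have hu₁ := hJ c mc 0
  -- Here u₁ₓ = c, u₂ = 0 and v₁ₓ = √t d, v₂ = c. So ⟨v, v⟩ = (t - 1)/4 changes sign at t = 1, while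
  -- ⟨u, u⟩ = 1/4, ⟨u, v⟩ = 0 and ω(u, v) = 1/4 do not depend on t.
  set u : TangentK s := (J c, 0)
  set v : TangentK s := (J (√t • d), (constants (s - 1)).mkQ c)
  have huu : metric 0 u u = 1 / 4 := by
    rw [metric_zero_eq hs, hu₁, hu₂, map_zero, mean_zero, prod, mcc]
    norm_num
  have hvv : metric 0 v v = (t - 1) / 4 := by
    rw [metric_zero_eq hs, hv₁, hv₂, prod, mcc, map_smul, map_smul, smul_apply, mean_smul,
      mean_smul, mdd, mul_one, Real.mul_self_sqrt ht]
    ring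
  have huv : metric 0 u v = 0 := by
    rw [metric_zero_eq hs, hu₁, hu₂, hv₁, hv₂, map_zero, zero_apply, mean_zero, prod, map_smul,
      mean_smul, mcd]
    norm_num
  have hω : symplectic u v = 1 / 4 := by
    rw [symplectic_eq hs, hu₁, hu₂, hv₁, hv₂, map_zero, zero_apply, mean_zero, prod, mcc]
    norm_num
  have hA : areaForm 0 u v = (t - 1) / 16 := by
    rw [areaForm, huu, hvv, huv]; ring
  have ht' : t - 1 ≠ 0 := sub_ne_zero.mpr ht1
  have hA0 : areaForm 0 u v ≠ 0 := by
    rw [hA]; positivity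
  refine ⟨u, v, hA0, ?_⟩
  rw [idK, sec, metric_curvatureTensor hs, huu, hvv, huv, hω, hA]
  field_simp
  ring

end HunterSaxton

end

/-! ### The theorem -/

open HunterSaxton in
theorem theorem3p8 (s : ℝ) (hs : 5 / 2 < s) :
    -- On vector fields, `R` at `(id, [0])` depends only on the values there.
    (∀ X Y Z : TangentK s → TangentK s,
      ContDiffOn ℝ ∞ X (K s) → ContDiffOn ℝ ∞ Y (K s) → ContDiffOn ℝ ∞ Z (K s) →
        curvature X Y Z (idK s) =
          curvatureTensor (idK s) (X (idK s)) (Y (idK s)) (Z (idK s))) ∧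
    (∀ u v : TangentK s,
      metric (idK s) (curvatureTensor (idK s) u v v) u =
        metric (idK s) u u * metric (idK s) v v - metric (idK s) u v ^ 2
          - 3 * symplectic u v ^ 2) ∧
    (∀ C : ℝ, ∃ u v : TangentK s, areaForm (idK s) u v ≠ 0 ∧ C < sec (idK s) u v) ∧
    (∀ C : ℝ, ∃ u v : TangentK s, areaForm (idK s) u v ≠ 0 ∧ sec (idK s) u v < C) := by
  refine ⟨fun X Y Z hX hY hZ => curvature_eq_curvatureTensor hs hX hY hZ,
    metric_curvatureTensor hs, fun C => ?_, fun C => ?_⟩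
  · have hC : 0 < |C| + 1 := by positivity
    have h1 : (|C| + 1)⁻¹ ≤ 1 := inv_le_one_of_one_le₀ (by linarith [abs_nonneg C])
    -- Taking t below 1 by 1/(|C| + 1) makes the curvature 1 + 3(|C| + 1).
    obtain ⟨u, v, hA, h⟩ := exists_sec_eq hs (t := 1 - (|C| + 1)⁻¹) (by linarith)
      (by simpa using hC.ne')
    refine ⟨u, v, hA, ?_⟩
    have h3 : 1 - 3 / (1 - (|C| + 1)⁻¹ - 1) = 1 + 3 * (|C| + 1) := by
      field_simp; ring
    rw [h, h3]
    linarith [le_abs_self C, abs_nonneg C]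
  · have hC : 0 < |C| + 1 := by positivity
    -- Taking t above 1 by the same amount makes it 1 - 3(|C| + 1).
    obtain ⟨u, v, hA, h⟩ := exists_sec_eq hs (t := 1 + (|C| + 1)⁻¹) (by positivity)
      (by simpa using hC.ne')
    refine ⟨u, v, hA, ?_⟩
    have h3 : 1 - 3 / (1 + (|C| + 1)⁻¹ - 1) = 1 - 3 * (|C| + 1) := by
      field_simp; ring
    rw [h, h3]
    linarith [neg_abs_le C, abs_nonneg C]
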